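/- Let $A,B,C$ be independent, uniformly distributed points on the unit sphere $S^2\subset\mathbb R^3$. In the random spherical triangle $ABC$, let $a,b\in[0,\pi]$ be the great-circle lengths of the sides $BC$ and $CA$ (so $a=\arccos\langle B,C\rangle$, $b=\arccos\langle C,A\rangle$), and let $\alpha\in[0,\pi]$ be the angle at $A$ (opposite the side $a$), i.e. the dihedral angle between the half-planes through $B$ and through $C$ bounded by the line $OA$. Then $$E\left(\alpha a \,\middle|\, b=\tfrac{\pi}{2}\right)=\frac14\int_0^{\pi}\left[2-{}_2F_1\left(\tfrac12,\tfrac12;2;\cos^2\theta\right)\cos\theta\right]\theta\,d\theta = 3.0538319164380270202505577\dots,$$ where ${}_2F_1(\tfrac12,\tfrac12;2;x)=\frac1\pi\sum_{n\ge0}\frac{\Gamma(n+1/2)^2}{\Gamma(n+2)}\frac{x^n}{n!}$ is the Gauss hypergeometric function, and all the displayed decimal digits are correct (truncated expansion). Here $E(\alpha a\mid b=\pi/2)$ means $g(\pi/2)$, where $\alpha a$ is integrable and $g$ is a continuous version of the regression function, that is, a continuous $g:\mathbb R\to\mathbb R$ with $E(\alpha a\mid\sigma(b))=g(b)$ almost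 surely; such a $g$ exists, and its value at $\pi/2$ is unique because $\pi/2$ lies in the support of the law of $b$. -/

import Mathlib

open MeasureTheory ProbabilityTheory Topology

/-- The unit sphere `S²` in Euclidean 3-space. -/
abbrev UnitSphere : Type := Metric.sphere (0 : EuclideanSpace ℝ (Fin 3)) 1

/-- The uniform probability measure on the unit sphere: surface measure divided by its total
mass. -/
noncomputable def uniformSphere : Measure UnitSphere :=
  ((volume : Measure (EuclideanSpace ℝ (Fin 3))).toSphere Set.univ)⁻¹ •
    (volume : Measure (EuclideanSpace ℝ (Fin 3))).toSphere

/-- Length in `[0, π]` of the great-circle side joining `P` and `Q`. -/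
noncomputable def sphSide (P Q : UnitSphere) : ℝ :=
  InnerProductGeometry.angle (P : EuclideanSpace ℝ (Fin 3)) (Q : EuclideanSpace ℝ (Fin 3))

/-- The component of `Q` orthogonal to `P`: a vector which, for `Q ≠ ±P`, is tangent at `P` to the
great-circle arc from `P` to `Q`. -/
noncomputable def sphTangent (P Q : UnitSphere) : EuclideanSpace ℝ (Fin 3) :=
  (Q : EuclideanSpace ℝ (Fin 3)) -
    (inner ℝ (P : EuclideanSpace ℝ (Fin 3)) (Q : EuclideanSpace ℝ (Fin 3))) •
      (P : EuclideanSpace ℝ (Fin 3))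

/-- The angle in `[0, π]` at the vertex `P` of the spherical triangle `P Q R`, i.e. the dihedral
angle between the half-planes bounded by the line through `0` and `P` and containing `Q` and `R`
respectively. -/
noncomputable def sphAngle (P Q R : UnitSphere) : ℝ :=
  InnerProductGeometry.angle (sphTangent P Q) (sphTangent P R)

/-- `E(X | Y = y) = e` for real random variables `X`, `Y`, where `{Y = y}` may be a null event:
the regression function `t ↦ E(X | Y = t)` has a continuous version `g`, and `g y = e`.
As `y` is required to lie in the support of the law of `Y`, the number `e` is unique
(`IsCondMeanAt.unique`). -/
structure IsCondMeanAt {Ω : Type*} [MeasurableSpace Ω] (μ : Measure Ω) (X Y : Ω → ℝ)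
    (y e : ℝ) : Prop where
  measurable : Measurable Y
  integrable : Integrable X μ
  mem_support : y ∈ (μ.map Y).support
  exists_version : ∃ g : ℝ → ℝ, Continuous g ∧
    μ[X | MeasurableSpace.comap Y inferInstance] =ᵐ[μ] (fun ω => g (Y ω)) ∧ g y = e

theorem IsCondMeanAt.unique {Ω : Type*} [MeasurableSpace Ω] {μ : Measure Ω} {X Y : Ω → ℝ}
    {y e e' : ℝ} (h : IsCondMeanAt μ X Y y e) (h' : IsCondMeanAt μ X Y y e') : e = e' := by
  obtain ⟨g, hg, hge, rfl⟩ := h.exists_version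
  obtain ⟨g', hg', hge', rfl⟩ := h'.exists_version
  by_contra hne
  have hU : {t | g t ≠ g' t} ∈ 𝓝 y := (isOpen_ne_fun hg hg').mem_nhds hne
  have hpos := (Measure.mem_support_iff_forall y).1 h.mem_support _ hU
  rw [Measure.map_apply h.measurable (isOpen_ne_fun hg hg').measurableSet] at hpos
  refine hpos.ne' ?_
  have : ∀ᵐ ω ∂μ, g (Y ω) = g' (Y ω) := hge.symm.trans hge'
  exact this

/-! By rotation invariance, the mean of `α a` over `B` with `A ≠ ±C` fixed depends only on `b`. Put
`A` at the north pole and `C` at colatitude `t` on the zero meridian: this gives `condMeanFun t`,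
continuous in `t`. Independence and Fubini show that it is a version of the regression function
(`isCondMeanAt_condMeanFun`).

For `t = π / 2` the point `C` is the first basis vector. If `B` has longitude `φ` and colatitude
`t`, then `α = |φ|` and `a = arccos (sin t * cos φ)`, with density `sin t / (4π)`. Expanding
`arccos` through the arcsine series and integrating the powers of `sin t` by Wallis turns the
integral over `t` into `π - (π / 2) * F(cos² φ) * cos φ`, where `F = ₂F₁(1/2, 1/2; 2; ·)`
(`sideMean_eq`). The stated integral follows.

For the digits, termwise integration gives the value `π² / 4 + S / 2` with `S = ∑ c_n K_n`, where
`c_n` (`hypCoeff`) are the Taylor coefficients of `F` and `-2 K_n` is the integral of `θ cos^(2n+1)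
θ` over `[0, π]` (`K_n` is `sinMoment`). Both sequences satisfy rational recurrences, so 250 terms
are summed exactly. The terms decay only like `n^(-5/2)`, so the tail is replaced by `c_n (P K_n +
Q)` with rational functions `P`, `Q` that make this expression telescope up to a tiny error
(`tailApprox_sub`). Machin's formula supplies `π`. -/

/-! ### Measurability and continuity of sides and angles. -/

open InnerProductGeometry in
theorem angle_measurable {α : Type*} [MeasurableSpace α] {f g : α → EuclideanSpace ℝ (Fin 3)}
    (hf : Measurable f) (hg : Measurable g) : Measurable fun x => angle (f x) (g x) := by
  unfold angle
  exact Real.continuous_arccos.measurable.comp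
    ((hf.inner hg).div (hf.norm.mul hg.norm))

theorem continuous_sphTangent : Continuous fun p : UnitSphere × UnitSphere => sphTangent p.1 p.2 := by
  unfold sphTangent
  fun_prop

theorem norm_unitSphere (P : UnitSphere) : ‖(P : EuclideanSpace ℝ (Fin 3))‖ = 1 :=
  norm_eq_of_mem_sphere P

theorem unitSphere_ne_zero (P : UnitSphere) : (P : EuclideanSpace ℝ (Fin 3)) ≠ 0 :=
  ne_zero_of_mem_unit_sphere P

theorem sphSide_eq_arccos (P Q : UnitSphere) :
    sphSide P Q = Real.arccos (inner ℝ (P : EuclideanSpace ℝ (Fin 3)) Q) := by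
  simp [sphSide, InnerProductGeometry.angle]

theorem continuous_sphSide : Continuous fun p : UnitSphere × UnitSphere => sphSide p.1 p.2 := by
  simp only [sphSide_eq_arccos]
  exact Real.continuous_arccos.comp (by fun_prop)

theorem measurable_sphAngle : Measurable fun p : (UnitSphere × UnitSphere) × UnitSphere =>
    sphAngle p.1.1 p.2 p.1.2 := by
  refine angle_measurable ?_ ?_
  · exact (continuous_sphTangent.comp (g := fun p : UnitSphere × UnitSphere => sphTangent p.1 p.2)
      (f := fun p : (UnitSphere × UnitSphere) × UnitSphere => (p.1.1, p.2))
      (by fun_prop)).measurable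
  · exact (continuous_sphTangent.comp (g := fun p : UnitSphere × UnitSphere => sphTangent p.1 p.2)
      (f := fun p : (UnitSphere × UnitSphere) × UnitSphere => (p.1.1, p.1.2))
      (by fun_prop)).measurable

/-! ### The uniform measure: total mass, rotation invariance, null points. -/

instance isProbabilityMeasure_uniformSphere : IsProbabilityMeasure uniformSphere := by
  constructor
  rw [uniformSphere, Measure.smul_apply, smul_eq_mul]
  refine ENNReal.inv_mul_cancel ?_ (measure_ne_top _ _)
  rw [Ne, Measure.measure_univ_eq_zero]
  exact Measure.toSphere_ne_zero _

instance isOpenPosMeasure_uniformSphere : uniformSphere.IsOpenPosMeasure := by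
  unfold uniformSphere
  exact Measure.isOpenPosMeasure_smul _ (ENNReal.inv_ne_zero.2 (measure_ne_top _ _))

/-- The action of a linear isometry on the unit sphere. -/
noncomputable def sphMap (L : EuclideanSpace ℝ (Fin 3) ≃ₗᵢ[ℝ] EuclideanSpace ℝ (Fin 3))
    (P : UnitSphere) : UnitSphere :=
  ⟨L P, by simp⟩

theorem continuous_sphMap (L : EuclideanSpace ℝ (Fin 3) ≃ₗᵢ[ℝ] EuclideanSpace ℝ (Fin 3)) :
    Continuous (sphMap L) := by
  unfold sphMap
  exact Continuous.subtype_mk (L.continuous.comp continuous_subtype_val) _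

-- The surface measure of `s` is a multiple of the volume of the cone `(0, 1) • s`, and a linear
-- isometry carries cones to cones and preserves volume.
open scoped Pointwise in
theorem measurePreserving_sphMap
    (L : EuclideanSpace ℝ (Fin 3) ≃ₗᵢ[ℝ] EuclideanSpace ℝ (Fin 3)) :
    MeasurePreserving (sphMap L) uniformSphere uniformSphere := by
  refine ⟨(continuous_sphMap L).measurable, ?_⟩
  unfold uniformSphere
  rw [Measure.map_smul]
  congr 1
  ext s hs
  rw [Measure.map_apply (continuous_sphMap L).measurable hs, Measure.toSphere_apply' _ hs,
    Measure.toSphere_apply' _ ((continuous_sphMap L).measurable hs)]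
  congr 1
  have : (Set.Ioo (0 : ℝ) 1 • ((↑) '' (sphMap L ⁻¹' s)) : Set (EuclideanSpace ℝ (Fin 3))) =
      L ⁻¹' (Set.Ioo (0 : ℝ) 1 • ((↑) '' s)) := by
    ext x
    simp only [Set.mem_smul, Set.mem_image, Set.mem_preimage]
    constructor
    · rintro ⟨r, hr, _, ⟨P, hP, rfl⟩, rfl⟩
      exact ⟨r, hr, _, ⟨_, hP, rfl⟩, by simp [sphMap]⟩
    · rintro ⟨r, hr, _, ⟨P, hP, rfl⟩, hx⟩
      refine ⟨r, hr, _, ⟨sphMap L.symm P, ?_, rfl⟩, ?_⟩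
      · have : sphMap L (sphMap L.symm P) = P := by ext1; simp [sphMap]
        rwa [this]
      · apply L.injective
        simp [sphMap, hx]
  rw [this]
  exact (L.measurePreserving).measure_preimage_equiv (f := L.toHomeomorph.toMeasurableEquiv) _

-- The cone over a single point lies in a line, which is Lebesgue null.
open scoped Pointwise in
instance nullSingletonClass_uniformSphere : NullSingletonClass uniformSphere := by
  constructor
  intro P
  rw [uniformSphere, Measure.smul_apply, Measure.toSphere_apply' _ (measurableSet_singleton _)]
  have : (volume : Measure (EuclideanSpace ℝ (Fin 3)))
      (Set.Ioo (0 : ℝ) 1 • ((↑) '' ({P} : Set UnitSphere))) = 0 := by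
    refine measure_mono_null ?_ (Measure.addHaar_submodule volume
      (Submodule.span ℝ {(P : EuclideanSpace ℝ (Fin 3))}) ?_)
    · rintro _ ⟨r, hr, _, ⟨Q, rfl, rfl⟩, rfl⟩
      exact Submodule.smul_mem _ _ (Submodule.mem_span_singleton_self _)
    · intro h
      have h1 := finrank_span_singleton (K := ℝ) (unitSphere_ne_zero P)
      rw [h, finrank_top, finrank_euclideanSpace_fin] at h1
      norm_num at h1
  rw [this]
  simp

/-! ### The regression function and its reduction to a standard position. -/

/-- The point of the unit sphere at colatitude `t` and longitude `φ`. -/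
noncomputable def sphPoint (φ t : ℝ) : EuclideanSpace ℝ (Fin 3) :=
  !₂[Real.sin t * Real.cos φ, Real.sin t * Real.sin φ, Real.cos t]

theorem norm_sphPoint (φ t : ℝ) : ‖sphPoint φ t‖ = 1 := by
  rw [EuclideanSpace.norm_eq, Real.sqrt_eq_one]
  simp only [sphPoint, Fin.sum_univ_three, Real.norm_eq_abs, sq_abs]
  simp
  nlinarith [Real.sin_sq_add_cos_sq t, Real.sin_sq_add_cos_sq φ]

open InnerProductGeometry in
/-- The conditional mean of `α a` given `b = t`, computed with `A` at the north pole and `C` on the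
meridian of longitude zero. -/
noncomputable def condMeanFun (t : ℝ) : ℝ :=
  ∫ B : UnitSphere, angle ((B : EuclideanSpace ℝ (Fin 3)) -
      (inner ℝ (EuclideanSpace.single 2 1) (B : EuclideanSpace ℝ (Fin 3))) •
        EuclideanSpace.single 2 1) (EuclideanSpace.single 0 1) *
    angle (B : EuclideanSpace ℝ (Fin 3)) (sphPoint 0 t) ∂uniformSphere

theorem abs_angle_mul_angle_le {V : Type*} [NormedAddCommGroup V] [InnerProductSpace ℝ V]
    (x y z w : V) : ‖InnerProductGeometry.angle x y * InnerProductGeometry.angle z w‖ ≤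
      Real.pi * Real.pi := by
  rw [norm_mul]
  have h (x y : V) : ‖InnerProductGeometry.angle x y‖ ≤ Real.pi := by
    rw [Real.norm_of_nonneg (InnerProductGeometry.angle_nonneg _ _)]
    exact InnerProductGeometry.angle_le_pi _ _
  gcongr <;> exact h _ _

/-- Only the factor `a` depends on `t`, continuously; dominated convergence applies with the bound
`π²`. -/
theorem continuous_condMeanFun : Continuous condMeanFun := by
  unfold condMeanFun
  refine continuous_of_dominated (bound := fun _ => Real.pi * Real.pi) ?_ ?_ ?_ ?_
  · intro t
    refine Measurable.aestronglyMeasurable (Measurable.mul ?_ ?_)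
    · exact angle_measurable (by fun_prop) measurable_const
    · exact angle_measurable (by fun_prop) measurable_const
  · exact fun t => Filter.Eventually.of_forall fun B => abs_angle_mul_angle_le _ _ _ _
  · exact integrable_const _
  · refine Filter.Eventually.of_forall fun B => continuous_const.mul ?_
    have : (fun t => InnerProductGeometry.angle (B : EuclideanSpace ℝ (Fin 3)) (sphPoint 0 t)) =
        fun t => Real.arccos (inner ℝ (B : EuclideanSpace ℝ (Fin 3)) (sphPoint 0 t)) := by
      ext t
      simp [InnerProductGeometry.angle, norm_sphPoint]
    rw [this]
    refine Real.continuous_arccos.comp (continuous_const.inner ?_)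
    unfold sphPoint
    refine (PiLp.continuous_toLp 2 _).comp ?_
    refine continuous_pi fun i => ?_
    fin_cases i <;> simp <;> fun_prop

theorem exists_isometry_of_orthonormal {e a : EuclideanSpace ℝ (Fin 3)} (he : ‖e‖ = 1)
    (ha : ‖a‖ = 1) (hea : inner ℝ e a = 0) :
    ∃ L : EuclideanSpace ℝ (Fin 3) ≃ₗᵢ[ℝ] EuclideanSpace ℝ (Fin 3),
      L (EuclideanSpace.single 0 1) = e ∧ L (EuclideanSpace.single 2 1) = a := by
  obtain ⟨b, hb⟩ := Orthonormal.exists_orthonormalBasis_extension_of_card_eq (𝕜 := ℝ)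
    (E := EuclideanSpace ℝ (Fin 3)) (ι := Fin 3) (by simp) (v := ![e, 0, a]) (s := {0, 2}) (by
      constructor
      · rintro ⟨i, hi⟩
        rcases hi with rfl | rfl <;> simp [Set.domRestrict, he, ha]
      · rintro ⟨i, hi⟩ ⟨j, hj⟩ hij
        rcases hi with rfl | rfl <;> rcases hj with rfl | rfl <;>
          simp_all [Set.domRestrict, real_inner_comm])
  refine ⟨(EuclideanSpace.basisFun (Fin 3) ℝ).equiv b (Equiv.refl _), ?_, ?_⟩
  · rw [← EuclideanSpace.basisFun_apply, OrthonormalBasis.equiv_apply_basis]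
    simpa using hb 0 (by simp)
  · rw [← EuclideanSpace.basisFun_apply, OrthonormalBasis.equiv_apply_basis]
    simpa using hb 2 (by simp)

/-- Since `C ≠ ±A`, the tangent at `A` towards `C` is nonzero, of length `sin t`. The isometry
sending the pole to `A` and the first basis vector to the normalised tangent sends `sphPoint 0 t` to
`C`; it preserves angles and the law of `B`. -/
theorem integral_sphAngle_mul_sphSide {A C : UnitSphere} (h0 : A ≠ C)
    (h1 : A ≠ -C) :
    ∫ B, sphAngle A B C * sphSide B C ∂uniformSphere = condMeanFun (sphSide C A) := by
  set t := sphSide C A with ht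
  have hcos : Real.cos t = inner ℝ (A : EuclideanSpace ℝ (Fin 3)) C := by
    rw [ht, sphSide, InnerProductGeometry.cos_angle, norm_unitSphere, norm_unitSphere,
      real_inner_comm]
    simp
  have hsin : 0 < Real.sin t := by
    refine Real.sin_pos_of_pos_of_lt_pi ?_ ?_
    · refine lt_of_le_of_ne (InnerProductGeometry.angle_nonneg _ _) fun h => h0 ?_
      have := (InnerProductGeometry.inner_eq_mul_norm_iff_angle_eq_zero
        (unitSphere_ne_zero C) (unitSphere_ne_zero A)).2 h.symm
      rw [norm_unitSphere, norm_unitSphere, mul_one,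
        inner_eq_one_iff_of_norm_eq_one (norm_unitSphere _) (norm_unitSphere _)] at this
      exact Subtype.ext this.symm
    · refine lt_of_le_of_ne (InnerProductGeometry.angle_le_pi _ _) fun h => h1 ?_
      have := (InnerProductGeometry.inner_eq_neg_mul_norm_iff_angle_eq_pi
        (unitSphere_ne_zero C) (unitSphere_ne_zero A)).2 h
      rw [norm_unitSphere, norm_unitSphere, mul_one,
        inner_eq_neg_one_iff_of_norm_eq_one (norm_unitSphere _) (norm_unitSphere _)] at this
      refine Subtype.ext ?_
      simp [this]
  have hAA : inner ℝ (A : EuclideanSpace ℝ (Fin 3)) A = 1 := by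
    rw [real_inner_self_eq_norm_sq, norm_unitSphere]; norm_num
  have hCC : inner ℝ (C : EuclideanSpace ℝ (Fin 3)) C = 1 := by
    rw [real_inner_self_eq_norm_sq, norm_unitSphere]; norm_num
  set w := sphTangent A C with hw
  have hAw : inner ℝ w (A : EuclideanSpace ℝ (Fin 3)) = 0 := by
    rw [hw, sphTangent, inner_sub_left, inner_smul_left, hAA, real_inner_comm]
    simp
  have hwn : ‖w‖ = Real.sin t := by
    have : ‖w‖ ^ 2 = Real.sin t ^ 2 := by
      rw [Real.sin_sq, ← real_inner_self_eq_norm_sq]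
      nth_rw 2 [hw]
      rw [sphTangent, inner_sub_right, inner_smul_right, hAw, hw, sphTangent, inner_sub_left,
        inner_smul_left, hCC, ← hcos]
      simp
      ring
    exact (sq_eq_sq₀ (norm_nonneg _) hsin.le).1 this
  obtain ⟨L, hL0, hL2⟩ := exists_isometry_of_orthonormal
    (e := (Real.sin t)⁻¹ • w) (a := A) (by
      rw [norm_smul, hwn, norm_inv, Real.norm_of_nonneg hsin.le, inv_mul_cancel₀ hsin.ne'])
    (norm_unitSphere A) (by rw [inner_smul_left, hAw, mul_zero])
  have hLw : w = Real.sin t • L (EuclideanSpace.single 0 1) := by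
    rw [hL0, smul_smul, mul_inv_cancel₀ hsin.ne', one_smul]
  have hLC : (C : EuclideanSpace ℝ (Fin 3)) = L (sphPoint 0 t) := by
    have h1 : sphPoint 0 t = Real.sin t • EuclideanSpace.single 0 1 +
        Real.cos t • EuclideanSpace.single 2 1 := by
      ext i
      fin_cases i <;> simp [sphPoint]
    rw [h1, map_add, map_smul, map_smul, ← hLw, hL2, hw, sphTangent, hcos]
    simp
  rw [← (measurePreserving_sphMap L).integral_comp' (f :=
    { toFun := sphMap L
      invFun := sphMap L.symm
      left_inv := fun P => by ext1; simp [sphMap]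
      right_inv := fun P => by ext1; simp [sphMap]
      measurable_toFun := (continuous_sphMap L).measurable
      measurable_invFun := (continuous_sphMap L.symm).measurable }), condMeanFun]
  refine integral_congr_ae (Filter.Eventually.of_forall fun B => ?_)
  show sphAngle A (sphMap L B) C * sphSide (sphMap L B) C = _
  congr 1
  · have hT : sphTangent A (sphMap L B) = L ((B : EuclideanSpace ℝ (Fin 3)) -
        inner ℝ (EuclideanSpace.single 2 1) (B : EuclideanSpace ℝ (Fin 3)) •
          EuclideanSpace.single 2 1) := by
      have h : inner ℝ (A : EuclideanSpace ℝ (Fin 3)) (L B) =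
          inner ℝ (EuclideanSpace.single 2 1) (B : EuclideanSpace ℝ (Fin 3)) := by
        rw [← hL2, L.inner_map_map]
      rw [map_sub, map_smul, hL2, ← h]
      rfl
    rw [sphAngle, ← hw, hLw, InnerProductGeometry.angle_smul_right_of_pos _ _ hsin, hT]
    exact LinearIsometry.angle_map L.toLinearIsometry _ _
  · rw [sphSide, hLC]
    exact LinearIsometry.angle_map L.toLinearIsometry _ _

/-! ### Identification of the conditional expectation. -/

theorem measurable_sphSide_swap :
    Measurable fun p : UnitSphere × UnitSphere => sphSide p.2 p.1 :=
  (continuous_sphSide.comp continuous_swap).measurable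

theorem measurable_sphAngle_mul_sphSide :
    Measurable fun p : (UnitSphere × UnitSphere) × UnitSphere =>
      sphAngle p.1.1 p.2 p.1.2 * sphSide p.2 p.1.2 :=
  measurable_sphAngle.mul ((continuous_sphSide.comp
    (f := fun p : (UnitSphere × UnitSphere) × UnitSphere => (p.2, p.1.2))
    (by fun_prop)).measurable)

theorem norm_condMeanFun_le (t : ℝ) : ‖condMeanFun t‖ ≤ Real.pi * Real.pi := by
  refine (norm_integral_le_of_norm_le_const (Filter.Eventually.of_forall fun B =>
    abs_angle_mul_angle_le _ _ _ _)).trans ?_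
  simp

theorem map_prodMk_prodMk_eq {Ω : Type*} [MeasurableSpace Ω] {μ : Measure Ω}
    [IsProbabilityMeasure μ]
    {A B C : Ω → UnitSphere} (hA : Measurable A) (hB : Measurable B) (hC : Measurable C)
    (hindep : iIndepFun ![A, B, C] μ) :
    μ.map (fun ω => (A ω, C ω)) = (μ.map A).prod (μ.map C) ∧
    μ.map (fun ω => ((A ω, C ω), B ω)) = ((μ.map A).prod (μ.map C)).prod (μ.map B) := by
  have hm : ∀ i, Measurable (![A, B, C] i) := by
    intro i; fin_cases i <;> assumption
  have h : IndepFun A C μ := hindep.indepFun (i := 0) (j := 2) (by decide)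
  have h' : IndepFun (fun ω => (A ω, C ω)) B μ :=
      hindep.indepFun_prodMk hm 0 2 1 (by decide) (by decide)
  have hAC := (indepFun_iff_map_prod_eq_prod_map_map hA.aemeasurable hC.aemeasurable).1 h
  refine ⟨hAC, ?_⟩
  rw [(indepFun_iff_map_prod_eq_prod_map_map (hA.prodMk hC).aemeasurable hB.aemeasurable).1 h',
    hAC]

theorem ae_ne_and_ne_neg :
    ∀ᵐ p ∂(uniformSphere.prod uniformSphere), p.1 ≠ p.2 ∧ p.1 ≠ -p.2 := by
  rw [Measure.ae_prod_iff_ae_ae]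
  · refine Filter.Eventually.of_forall fun P => ?_
    have h1 : ∀ᵐ Q ∂uniformSphere, Q ≠ P := Measure.ae_ne _ _
    have h2 : ∀ᵐ Q ∂uniformSphere, Q ≠ -P := Measure.ae_ne _ _
    filter_upwards [h1, h2] with Q hQ1 hQ2
    exact ⟨hQ1.symm, fun h => hQ2 (by rw [h, neg_neg])⟩
  · exact (MeasurableSet.compl (isClosed_eq continuous_fst
      continuous_snd).measurableSet).inter (MeasurableSet.compl (isClosed_eq continuous_fst
      continuous_snd.neg).measurableSet)

/-- The side is continuous and attains `t`, so a neighbourhood of `t` pulls back to a set containing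
a nonempty open one, which has positive measure. -/
theorem mem_support_map_sphSide {t : ℝ} (ht : t ∈ Set.Icc 0 Real.pi) :
    t ∈ ((uniformSphere.prod uniformSphere).map
      fun p : UnitSphere × UnitSphere => sphSide p.2 p.1).support := by
  rw [Measure.mem_support_iff_forall]
  intro U hU
  obtain ⟨V, hVU, hVo, htV⟩ := mem_nhds_iff.1 hU
  refine lt_of_lt_of_le ?_ (measure_mono hVU)
  rw [Measure.map_apply measurable_sphSide_swap hVo.measurableSet]
  refine (hVo.preimage (continuous_sphSide.comp continuous_swap)).measure_pos _ ?_
  refine ⟨(⟨sphPoint 0 t, by simp [norm_sphPoint]⟩, ⟨sphPoint 0 0, by simp [norm_sphPoint]⟩), ?_⟩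
  have : sphSide ⟨sphPoint 0 0, by simp [norm_sphPoint]⟩
      ⟨sphPoint 0 t, by simp [norm_sphPoint]⟩ = t := by
    rw [sphSide_eq_arccos]
    simp [sphPoint, PiLp.inner_apply, Fin.sum_univ_three, Real.arccos_cos ht.1 ht.2]
  rw [Set.mem_preimage]
  exact (congrArg (· ∈ V) this).mpr htV

/-- The defining identity of the conditional expectation on an event `b ∈ T`, transported to the
product of spheres: Fubini integrates over `B` first, and pairs with `A = ±C` are null. -/
theorem setIntegral_condMeanFun {T : Set ℝ} (hT : MeasurableSet T) :
    ∫ p in (fun p : UnitSphere × UnitSphere => sphSide p.2 p.1) ⁻¹' T,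
        condMeanFun (sphSide p.2 p.1) ∂(uniformSphere.prod uniformSphere) =
      ∫ p in ((fun p : UnitSphere × UnitSphere => sphSide p.2 p.1) ⁻¹' T) ×ˢ Set.univ,
        sphAngle p.1.1 p.2 p.1.2 * sphSide p.2 p.1.2
          ∂((uniformSphere.prod uniformSphere).prod uniformSphere) := by
  rw [setIntegral_prod]
  · refine setIntegral_congr_ae (measurable_sphSide_swap hT) ?_
    filter_upwards [ae_ne_and_ne_neg] with p hp _
    simp only [Measure.restrict_univ]
    exact (integral_sphAngle_mul_sphSide hp.1 hp.2).symm
  · exact Integrable.integrableOn (Integrable.of_bound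
      measurable_sphAngle_mul_sphSide.aestronglyMeasurable (Real.pi * Real.pi)
      (Filter.Eventually.of_forall fun p => abs_angle_mul_angle_le _ _ _ _))

theorem isCondMeanAt_condMeanFun {Ω : Type*} [MeasurableSpace Ω] (μ : Measure Ω)
    [IsProbabilityMeasure μ]
    (A B C : Ω → UnitSphere) (hA : Measurable A) (hB : Measurable B) (hC : Measurable C)
    (hindep : iIndepFun ![A, B, C] μ)
    (hAlaw : μ.map A = uniformSphere) (hBlaw : μ.map B = uniformSphere)
    (hClaw : μ.map C = uniformSphere) {t : ℝ} (ht : t ∈ Set.Icc 0 Real.pi) :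
    IsCondMeanAt μ
      (fun ω => sphAngle (A ω) (B ω) (C ω) * sphSide (B ω) (C ω))
      (fun ω => sphSide (C ω) (A ω)) t (condMeanFun t) := by
  obtain ⟨hAC, hACB⟩ := map_prodMk_prodMk_eq hA hB hC hindep
  rw [hAlaw, hClaw] at hAC
  rw [hAlaw, hClaw, hBlaw] at hACB
  have hAC' : Measurable fun ω => (A ω, C ω) := hA.prodMk hC
  have hACB' : Measurable fun ω => ((A ω, C ω), B ω) := hAC'.prodMk hB
  have hY : Measurable fun ω => sphSide (C ω) (A ω) := by
    have h := measurable_sphSide_swap.comp hAC'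
    simpa only [Function.comp_def] using h
  have hX : Measurable fun ω => sphAngle (A ω) (B ω) (C ω) * sphSide (B ω) (C ω) := by
    have h := measurable_sphAngle_mul_sphSide.comp hACB'
    simpa only [Function.comp_def] using h
  have hXi : Integrable (fun ω => sphAngle (A ω) (B ω) (C ω) * sphSide (B ω) (C ω)) μ :=
    Integrable.of_bound hX.aestronglyMeasurable
      (Real.pi * Real.pi) (Filter.Eventually.of_forall fun ω => abs_angle_mul_angle_le _ _ _ _)
  have hgi : Integrable (fun ω => condMeanFun (sphSide (C ω) (A ω))) μ :=
    Integrable.of_bound (continuous_condMeanFun.measurable.comp hY).aestronglyMeasurable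
      (Real.pi * Real.pi) (Filter.Eventually.of_forall fun ω => norm_condMeanFun_le _)
  refine ⟨hY, hXi, ?_, condMeanFun, continuous_condMeanFun, ?_, rfl⟩
  · have := mem_support_map_sphSide ht
    rw [← hAC, Measure.map_map measurable_sphSide_swap hAC'] at this
    simpa only [Function.comp_def] using this
  · symm
    refine ae_eq_condExp_of_forall_setIntegral_eq hY.comap_le hXi
      (fun s _ _ => hgi.integrableOn) ?_ ?_
    · rintro _ ⟨T, hT, rfl⟩ -
      have h := setIntegral_condMeanFun hT
      have hgm : AEStronglyMeasurable
          (fun p : UnitSphere × UnitSphere => condMeanFun (sphSide p.2 p.1))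
          (μ.map fun ω => (A ω, C ω)) :=
        (continuous_condMeanFun.measurable.comp measurable_sphSide_swap).aestronglyMeasurable
      rw [← hAC, setIntegral_map (measurable_sphSide_swap hT) hgm hAC'.aemeasurable, hAC, ← hACB, setIntegral_map
        ((measurable_sphSide_swap hT).prod MeasurableSet.univ)
        measurable_sphAngle_mul_sphSide.aestronglyMeasurable hACB'.aemeasurable] at h
      have hset : (fun ω => ((A ω, C ω), B ω)) ⁻¹'
          (((fun p : UnitSphere × UnitSphere => sphSide p.2 p.1) ⁻¹' T) ×ˢ Set.univ) =
          (fun ω => sphSide (C ω) (A ω)) ⁻¹' T := by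
        ext ω
        simp
      rw [hset] at h
      exact h
    · refine StronglyMeasurable.aestronglyMeasurable ?_
      exact (continuous_condMeanFun.measurable.comp
        (comap_measurable fun ω => sphSide (C ω) (A ω))).stronglyMeasurable

/-! ### Integration over the sphere in spherical coordinates. -/

theorem lintegral_toSphere_eq {f : EuclideanSpace ℝ (Fin 3) → ENNReal} (hf : Measurable f)
    (hhom : ∀ (r : ℝ) (x : EuclideanSpace ℝ (Fin 3)), 0 < r → f (r • x) = f x) :
    ∫⁻ x in Metric.ball 0 1, f x =
      (∫⁻ P : UnitSphere, f P ∂((volume : Measure (EuclideanSpace ℝ (Fin 3))).toSphere)) *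
        ENNReal.ofReal (1 / 3) := by
  have hr : (1 : ℝ) ∈ Set.Ioi (0 : ℝ) := by simp
  have h := (volume : Measure (EuclideanSpace ℝ
    (Fin 3))).measurePreserving_homeomorphUnitSphereProd.lintegral_comp_emb
      (Homeomorph.measurableEmbedding _)
      (fun p => f p.1 * (Set.Iio (⟨1, hr⟩ : Set.Ioi (0 : ℝ))).indicator 1 p.2)
  rw [lintegral_prod_mul (f := fun P : UnitSphere => f P) (hf.comp measurable_subtype_coe).aemeasurable
    ((measurable_one.indicator measurableSet_Iio).aemeasurable),
    lintegral_indicator_one measurableSet_Iio, Measure.volumeIoiPow_apply_Iio] at h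
  -- The radial mass of the unit ball: the integral of `r²` over `(0, 1)`.
  have h2 : (1 : ℝ) ^ (Module.finrank ℝ (EuclideanSpace ℝ (Fin 3)) - 1 + 1) /
      ((Module.finrank ℝ (EuclideanSpace ℝ (Fin 3)) - 1 : ℕ) + 1) = 1 / 3 := by
    rw [finrank_euclideanSpace_fin]; norm_num
  simp only [h2] at h
  have h0 (g : EuclideanSpace ℝ (Fin 3) → ENNReal) : ∫⁻ x, g x =
      ∫⁻ x : ({0}ᶜ : Set (EuclideanSpace ℝ (Fin 3))), g x ∂(volume.comap Subtype.val) := by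
    rw [lintegral_subtype_comap (measurableSet_singleton _).compl, restrict_compl_singleton]
  rw [← h, ← lintegral_indicator Metric.isOpen_ball.measurableSet, h0]
  refine lintegral_congr fun x => ?_
  have hx : 0 < ‖(x : EuclideanSpace ℝ (Fin 3))‖ := norm_pos_iff.2 x.2
  have h3 : f ((homeomorphUnitSphereProd (EuclideanSpace ℝ (Fin 3)) x).1) = f x := by
    rw [homeomorphUnitSphereProd_apply_fst_coe, hhom _ _ (inv_pos.2 hx)]
  rw [h3]
  by_cases hx1 : ‖(x : EuclideanSpace ℝ (Fin 3))‖ < 1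
  · rw [Set.indicator_of_mem (by simpa using hx1), Set.indicator_of_mem]
    · simp
    · rw [Set.mem_Iio, ← Subtype.coe_lt_coe]
      simpa using hx1
  · rw [Set.indicator_of_notMem (by simpa using hx1), Set.indicator_of_notMem]
    · simp
    · rw [Set.mem_Iio, ← Subtype.coe_lt_coe]
      simpa using hx1

theorem lintegral_euclideanSpace_three {H : EuclideanSpace ℝ (Fin 3) → ENNReal}
    (hH : Measurable H) :
    ∫⁻ x, H x = ∫⁻ z : ℝ, ∫⁻ p : ℝ × ℝ, H !₂[p.1, p.2, z] := by
  have e1 := (EuclideanSpace.volume_preserving_symm_measurableEquiv_toLp (Fin 3)).symm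
  have e2 := (volume_preserving_piFinSuccAbove (fun _ : Fin 3 => ℝ) 2).symm
  have e3 := (volume_preserving_finTwoArrow ℝ).symm
  rw [← e1.lintegral_comp_emb (MeasurableEquiv.measurableEmbedding _),
    ← e2.lintegral_comp_emb (MeasurableEquiv.measurableEmbedding _), Measure.volume_eq_prod,
    lintegral_prod _ (by
      exact (hH.comp ((MeasurableEquiv.measurable _).comp
        (MeasurableEquiv.measurable _))).aemeasurable)]
  refine lintegral_congr fun z => ?_
  rw [← e3.lintegral_comp_emb (MeasurableEquiv.measurableEmbedding _)]
  refine lintegral_congr fun p => ?_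
  congr 1
  ext i
  fin_cases i <;> rfl

theorem continuous_vec3 : Continuous fun p : ℝ × ℝ × ℝ => !₂[p.1, p.2.1, p.2.2] := by
  refine (PiLp.continuous_toLp 2 _).comp ?_
  refine continuous_pi fun i => ?_
  fin_cases i <;> simp <;> fun_prop

/-- Planar polar coordinates are used twice: first in the horizontal plane, giving `(ρ, φ)`, then in
the `(z, ρ)` plane, with `z = r cos t` and `ρ = r sin t`. The Jacobian is `ρ * r = r² sin t`.
Extending by zero to `ρ ≤ 0` kills the angles `t ≤ 0` of the second change. -/
theorem lintegral_spherical {H : EuclideanSpace ℝ (Fin 3) → ENNReal} (hH : Measurable H) :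
    ∫⁻ x, H x = ∫⁻ φ in Set.Ioo (-Real.pi) Real.pi, ∫⁻ t in Set.Ioo 0 Real.pi,
      ∫⁻ r in Set.Ioi 0, ENNReal.ofReal (r ^ 2 * Real.sin t) * H (r • sphPoint φ t) := by
  have hT : polarCoord.target = Set.Ioi (0 : ℝ) ×ˢ Set.Ioo (-Real.pi) Real.pi := rfl
  have hv : ∀ {α : Type} [MeasurableSpace α] {a b c : α → ℝ}, Measurable a → Measurable b →
      Measurable c → Measurable fun x => H !₂[a x, b x, c x] := fun ha hb hc =>
    hH.comp (continuous_vec3.measurable.comp (ha.prodMk (hb.prodMk hc)))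
  have e1 : ∫⁻ x, H x = ∫⁻ z : ℝ, ∫⁻ φ in Set.Ioo (-Real.pi) Real.pi, ∫⁻ ρ in Set.Ioi 0,
      ENNReal.ofReal ρ * H !₂[ρ * Real.cos φ, ρ * Real.sin φ, z] := by
    rw [lintegral_euclideanSpace_three hH]
    refine lintegral_congr fun z => ?_
    rw [← lintegral_comp_polarCoord_symm, hT, Measure.volume_eq_prod, ← Measure.prod_restrict,
      lintegral_prod_symm _ (by
        refine Measurable.aemeasurable ?_
        refine Measurable.smul (measurable_fst.ennreal_ofReal) ?_
        simp only [polarCoord_symm_apply]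
        exact hv (by fun_prop) (by fun_prop) (by fun_prop))]
    rfl
  have e2 : ∀ φ : ℝ, ∫⁻ z : ℝ, ∫⁻ ρ in Set.Ioi 0,
      ENNReal.ofReal ρ * H !₂[ρ * Real.cos φ, ρ * Real.sin φ, z] =
      ∫⁻ t in Set.Ioo 0 Real.pi,
        ∫⁻ r in Set.Ioi 0, ENNReal.ofReal (r ^ 2 * Real.sin t) * H (r • sphPoint φ t) := by
    intro φ
    set K : ℝ × ℝ → ENNReal := fun p => (Set.Ioi (0 : ℝ)).indicator (fun ρ =>
      ENNReal.ofReal ρ * H !₂[ρ * Real.cos φ, ρ * Real.sin φ, p.1]) p.2 with hK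
    have hK' : K = Set.indicator {p : ℝ × ℝ | 0 < p.2} (fun p => ENNReal.ofReal p.2 *
        H !₂[p.2 * Real.cos φ, p.2 * Real.sin φ, p.1]) := by
      ext p
      simp [hK, Set.indicator]
    have hKm : Measurable K := by
      rw [hK']
      refine Measurable.indicator ?_ (measurableSet_lt measurable_const measurable_snd)
      exact Measurable.mul (by fun_prop) (hv (by fun_prop) (by fun_prop) (by fun_prop))
    have e3 : ∫⁻ z : ℝ, ∫⁻ ρ in Set.Ioi 0,
        ENNReal.ofReal ρ * H !₂[ρ * Real.cos φ, ρ * Real.sin φ, z] = ∫⁻ p, K p := by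
      rw [Measure.volume_eq_prod, lintegral_prod _ hKm.aemeasurable]
      refine lintegral_congr fun z => ?_
      rw [← lintegral_indicator measurableSet_Ioi]
    rw [e3, ← lintegral_comp_polarCoord_symm, hT, Measure.volume_eq_prod, ← Measure.prod_restrict,
      lintegral_prod_symm _ (by
        refine Measurable.aemeasurable ?_
        refine Measurable.smul (measurable_fst.ennreal_ofReal) (hKm.comp
          continuous_polarCoord_symm.measurable))]
    have hsub : Set.Ioo (0 : ℝ) Real.pi ⊆ Set.Ioo (-Real.pi) Real.pi :=
      Set.Ioo_subset_Ioo_left (by linarith [Real.pi_pos])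
    rw [← lintegral_indicator measurableSet_Ioo, ← lintegral_indicator measurableSet_Ioo]
    refine lintegral_congr fun t => ?_
    by_cases ht : t ∈ Set.Ioo 0 Real.pi
    · rw [Set.indicator_of_mem ht, Set.indicator_of_mem (hsub ht)]
      refine setLIntegral_congr_fun measurableSet_Ioi fun r hr => ?_
      have hr' : 0 < r := hr
      have hs : 0 < r * Real.sin t := mul_pos hr' (Real.sin_pos_of_mem_Ioo ht)
      simp only [polarCoord_symm_apply, hK, smul_eq_mul]
      rw [Set.indicator_of_mem (Set.mem_Ioi.2 hs), ← mul_assoc, ← ENNReal.ofReal_mul hr'.le]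
      congr 2
      · ring
      · ext i
        fin_cases i <;> simp [sphPoint] <;> ring
    · rw [Set.indicator_of_notMem ht]
      by_cases ht' : t ∈ Set.Ioo (-Real.pi) Real.pi
      · rw [Set.indicator_of_mem ht', setLIntegral_congr_fun measurableSet_Ioi (g := fun _ => 0)]
        · simp
        · intro r hr
          have hr' : 0 < r := hr
          have hs : ¬ 0 < r * Real.sin t := by
            have : t ≤ 0 := by
              by_contra h
              exact ht ⟨not_le.1 h, ht'.2⟩
            have := Real.sin_nonpos_of_nonpos_of_neg_pi_le this ht'.1.le
            nlinarith
          simp only [polarCoord_symm_apply, hK, smul_eq_mul]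
          rw [Set.indicator_of_notMem (by rwa [Set.mem_Ioi]), mul_zero]
      · rw [Set.indicator_of_notMem ht']
  rw [e1, lintegral_lintegral_swap]
  · exact lintegral_congr fun φ => e2 φ
  · refine Measurable.aemeasurable ?_
    refine Measurable.lintegral_prod_right (f := fun (p : ℝ × ℝ) (r : ℝ) => ENNReal.ofReal r *
      H !₂[r * Real.cos p.2, r * Real.sin p.2, p.1]) ?_
    exact Measurable.mul (by fun_prop) (hv (by fun_prop) (by fun_prop) (by fun_prop))

/-- For `f` homogeneous of degree zero, the integral over the unit ball is computed by the polar
decomposition and by spherical coordinates; the common radial factor `1 / 3` cancels. -/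
theorem lintegral_uniformSphere {f : EuclideanSpace ℝ (Fin 3) → ENNReal} (hf : Measurable f)
    (hhom : ∀ (r : ℝ) (x : EuclideanSpace ℝ (Fin 3)), 0 < r → f (r • x) = f x) :
    ∫⁻ P : UnitSphere, f P ∂uniformSphere = ENNReal.ofReal (1 / (4 * Real.pi)) *
      ∫⁻ φ in Set.Ioo (-Real.pi) Real.pi, ∫⁻ t in Set.Ioo 0 Real.pi,
        ENNReal.ofReal (Real.sin t) * f (sphPoint φ t) := by
  have hπ := Real.pi_pos
  have h13 : ENNReal.ofReal (1 / 3) ≠ 0 := by simp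
  have h1 := lintegral_toSphere_eq hf hhom
  have h2 : ∫⁻ x in Metric.ball 0 1, f x =
      (∫⁻ φ in Set.Ioo (-Real.pi) Real.pi, ∫⁻ t in Set.Ioo 0 Real.pi,
        ENNReal.ofReal (Real.sin t) * f (sphPoint φ t)) * ENNReal.ofReal (1 / 3) := by
    rw [← lintegral_indicator Metric.isOpen_ball.measurableSet,
      lintegral_spherical (hf.indicator Metric.isOpen_ball.measurableSet),
      ← lintegral_mul_const' _ _ ENNReal.ofReal_ne_top]
    refine lintegral_congr fun φ => ?_
    rw [← lintegral_mul_const' _ _ ENNReal.ofReal_ne_top]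
    refine setLIntegral_congr_fun measurableSet_Ioo fun t ht => ?_
    have hs := Real.sin_pos_of_mem_Ioo ht
    have h3 : ∫⁻ r in Set.Ioi 0, ENNReal.ofReal (r ^ 2 * Real.sin t) *
        (Metric.ball 0 1).indicator f (r • sphPoint φ t) = ∫⁻ r in Set.Ioi 0,
          (ENNReal.ofReal (Real.sin t) * f (sphPoint φ t)) *
            (Set.Iio (1 : ℝ)).indicator (fun r => ENNReal.ofReal (r ^ 2)) r := by
      refine setLIntegral_congr_fun measurableSet_Ioi fun r hr => ?_
      have hr' : 0 < r := hr
      have hn : ‖r • sphPoint φ t‖ = r := by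
        rw [norm_smul, norm_sphPoint, mul_one, Real.norm_of_nonneg hr'.le]
      by_cases hr1 : r < 1
      · rw [Set.indicator_of_mem (by simpa [hn] using hr1), Set.indicator_of_mem
          (Set.mem_Iio.2 hr1), hhom _ _ hr', ENNReal.ofReal_mul (by positivity)]
        ring
      · rw [Set.indicator_of_notMem (by simpa [hn] using hr1), Set.indicator_of_notMem
          (by simpa using hr1)]
        simp
    rw [h3, lintegral_const_mul _ ((by fun_prop : Measurable fun r : ℝ =>
      ENNReal.ofReal (r ^ 2)).indicator measurableSet_Iio)]
    congr 1
    rw [lintegral_indicator measurableSet_Iio, Measure.restrict_restrict measurableSet_Iio,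
      Set.inter_comm, Set.Ioi_inter_Iio, Measure.restrict_congr_set Ioo_ae_eq_Ioc,
      ← ofReal_integral_eq_lintegral_ofReal (intervalIntegral.intervalIntegrable_pow _).1
        (Filter.Eventually.of_forall fun r => sq_nonneg r),
      ← intervalIntegral.integral_of_le zero_le_one]
    norm_num
  have h4 := (ENNReal.mul_left_inj h13 ENNReal.ofReal_ne_top).1 (h1.symm.trans h2)
  rw [uniformSphere, lintegral_smul_measure, h4, Measure.toSphere_apply_univ,
    EuclideanSpace.volume_ball_fin_three, finrank_euclideanSpace_fin, smul_eq_mul]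
  congr 1
  rw [one_div, ENNReal.ofReal_inv_of_pos (by positivity), ENNReal.ofReal_one, one_pow, one_mul]
  congr 1
  rw [show 4 * Real.pi = 3 * (Real.pi * 4 / 3) by ring, ENNReal.ofReal_mul (by norm_num)]
  simp

/-! ### The case `b = π / 2` as a double integral. -/

/-- The mean of the side `a`, up to the normalisation of the measure, when `b = π / 2` and the
angle at `A` is `φ`. -/
noncomputable def sideMean (φ : ℝ) : ℝ :=
  ∫ t in (0 : ℝ)..Real.pi, Real.sin t * Real.arccos (Real.sin t * Real.cos φ)

theorem continuous_sideMean : Continuous sideMean := by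
  unfold sideMean
  refine intervalIntegral.continuous_parametric_intervalIntegral_of_continuous' ?_ _ _
  have := Real.continuous_arccos
  simp only [Function.uncurry_def]
  fun_prop

theorem sideMean_nonneg (φ : ℝ) : 0 ≤ sideMean φ :=
  intervalIntegral.integral_nonneg Real.pi_pos.le fun _ ht =>
    mul_nonneg (Real.sin_nonneg_of_mem_Icc ht) (Real.arccos_nonneg _)

theorem angle_sphPoint_single (φ t : ℝ) :
    InnerProductGeometry.angle (sphPoint φ t) (EuclideanSpace.single 0 1) =
      Real.arccos (Real.sin t * Real.cos φ) := by
  have h : inner ℝ (sphPoint φ t) (EuclideanSpace.single 0 1) = Real.sin t * Real.cos φ := by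
    rw [EuclideanSpace.inner_single_right]
    simp [sphPoint]
  have h1 : ‖(EuclideanSpace.single 0 1 : EuclideanSpace ℝ (Fin 3))‖ = 1 := by simp
  rw [InnerProductGeometry.angle, norm_sphPoint, h, h1]
  norm_num

theorem sphPoint_sub_inner_smul (φ t : ℝ) :
    sphPoint φ t - (inner ℝ (EuclideanSpace.single 2 1) (sphPoint φ t)) •
      EuclideanSpace.single 2 1 = Real.sin t • sphPoint φ (Real.pi / 2) := by
  have h : inner ℝ (EuclideanSpace.single 2 1) (sphPoint φ t) = Real.cos t := by
    rw [EuclideanSpace.inner_single_left]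
    simp [sphPoint]
  rw [h]
  ext i
  fin_cases i <;> simp [sphPoint]

theorem condMeanFun_pi_div_two :
    condMeanFun (Real.pi / 2) =
      1 / (2 * Real.pi) * ∫ φ in (0 : ℝ)..Real.pi, φ * sideMean φ := by
  have hπ := Real.pi_pos
  have he : sphPoint 0 (Real.pi / 2) = EuclideanSpace.single 0 1 := by
    ext i
    fin_cases i <;> simp [sphPoint]
  set F : EuclideanSpace ℝ (Fin 3) → ℝ := fun x =>
    InnerProductGeometry.angle (x - (inner ℝ (EuclideanSpace.single 2 1) x) •
        EuclideanSpace.single 2 1) (EuclideanSpace.single 0 1) *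
      InnerProductGeometry.angle x (EuclideanSpace.single 0 1) with hF
  have hFm : Measurable F :=
    (angle_measurable (by fun_prop) measurable_const).mul
      (angle_measurable (by fun_prop) measurable_const)
  have hF0 : ∀ x, 0 ≤ F x := fun x =>
    mul_nonneg (InnerProductGeometry.angle_nonneg _ _) (InnerProductGeometry.angle_nonneg _ _)
  have hFhom : ∀ (r : ℝ) (x : EuclideanSpace ℝ (Fin 3)), 0 < r → F (r • x) = F x := by
    intro r x hr
    simp only [hF]
    rw [inner_smul_right, mul_smul, ← smul_sub, InnerProductGeometry.angle_smul_left_of_pos _ _ hr,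
      InnerProductGeometry.angle_smul_left_of_pos _ _ hr]
  -- The tangent at the pole towards `B` is a positive multiple of the equatorial point of longitude
  -- `φ`, hence makes the angle `|φ|` with the direction of `C`.
  have hFs : ∀ φ ∈ Set.Ioo (-Real.pi) Real.pi, ∀ t ∈ Set.Ioo 0 Real.pi,
      F (sphPoint φ t) = |φ| * Real.arccos (Real.sin t * Real.cos φ) := by
    intro φ hφ t ht
    have hs := Real.sin_pos_of_mem_Ioo ht
    simp only [hF]
    rw [sphPoint_sub_inner_smul, InnerProductGeometry.angle_smul_left_of_pos _ _ hs,
      angle_sphPoint_single, angle_sphPoint_single, Real.sin_pi_div_two, one_mul,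
      ← Real.cos_abs φ, Real.arccos_cos (abs_nonneg _) (abs_le.2 ⟨hφ.1.le, hφ.2.le⟩)]
  have h1 : condMeanFun (Real.pi / 2) = ∫ P : UnitSphere, F P ∂uniformSphere := by
    rw [condMeanFun, he]
  have hac := Real.continuous_arccos
  have h2 : ∀ φ ∈ Set.Ioo (-Real.pi) Real.pi, ∫⁻ t in Set.Ioo 0 Real.pi,
      ENNReal.ofReal (Real.sin t) * ENNReal.ofReal (F (sphPoint φ t)) =
      ENNReal.ofReal (|φ| * sideMean φ) := by
    intro φ hφ
    have e : ∀ t ∈ Set.Ioo 0 Real.pi, ENNReal.ofReal (Real.sin t) *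
        ENNReal.ofReal (F (sphPoint φ t)) = ENNReal.ofReal
          (|φ| * (Real.sin t * Real.arccos (Real.sin t * Real.cos φ))) := by
      intro t ht
      rw [hFs φ hφ t ht, ← ENNReal.ofReal_mul (Real.sin_pos_of_mem_Ioo ht).le]
      congr 1
      ring
    rw [setLIntegral_congr_fun measurableSet_Ioo e, Measure.restrict_congr_set Ioo_ae_eq_Ioc,
      ← ofReal_integral_eq_lintegral_ofReal, ← intervalIntegral.integral_of_le hπ.le,
      intervalIntegral.integral_const_mul, sideMean]
    · exact (Continuous.intervalIntegrable (by fun_prop) 0 Real.pi).1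
    · rw [Filter.EventuallyLE, ae_restrict_iff' measurableSet_Ioc]
      exact Filter.Eventually.of_forall fun t ht => mul_nonneg (abs_nonneg _)
        (mul_nonneg (Real.sin_nonneg_of_mem_Icc ⟨ht.1.le, ht.2⟩) (Real.arccos_nonneg _))
  have hcont : Continuous fun φ => |φ| * sideMean φ := continuous_abs.mul continuous_sideMean
  have h3 : ∫ φ in (-Real.pi)..Real.pi, |φ| * sideMean φ =
      2 * ∫ φ in (0 : ℝ)..Real.pi, φ * sideMean φ := by
    rw [← intervalIntegral.integral_add_adjacent_intervals (hcont.intervalIntegrable _ 0)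
      (hcont.intervalIntegrable 0 _), two_mul]
    have e2 : ∫ φ in (0 : ℝ)..Real.pi, |φ| * sideMean φ =
        ∫ φ in (0 : ℝ)..Real.pi, φ * sideMean φ := by
      refine intervalIntegral.integral_congr fun φ hφ => ?_
      rw [Set.uIcc_of_le hπ.le] at hφ
      simp only [abs_of_nonneg hφ.1]
    have e3 : ∫ φ in (-Real.pi)..0, |φ| * sideMean φ =
        ∫ φ in (0 : ℝ)..Real.pi, |φ| * sideMean φ := by
      have := intervalIntegral.integral_comp_neg (a := 0) (b := Real.pi)
        (fun φ => |φ| * sideMean φ)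
      simp only [neg_zero, abs_neg] at this
      rw [← this]
      simp [sideMean]
    rw [e3, e2]
  rw [h1, integral_eq_lintegral_of_nonneg_ae (Filter.Eventually.of_forall fun P => hF0 _)
    (hFm.comp measurable_subtype_coe).aestronglyMeasurable,
    lintegral_uniformSphere (f := fun x => ENNReal.ofReal (F x)) hFm.ennreal_ofReal
      (fun r x hr => by rw [hFhom r x hr]),
    setLIntegral_congr_fun measurableSet_Ioo h2, Measure.restrict_congr_set Ioo_ae_eq_Ioc,
    ← ofReal_integral_eq_lintegral_ofReal,
    ← intervalIntegral.integral_of_le (by linarith), h3, ← ENNReal.ofReal_mul (by positivity),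
    ENNReal.toReal_ofReal]
  · field_simp
    norm_num
  · refine mul_nonneg (by positivity) (mul_nonneg zero_le_two ?_)
    exact intervalIntegral.integral_nonneg hπ.le fun φ hφ => mul_nonneg hφ.1 (sideMean_nonneg _)
  · exact (hcont.intervalIntegrable (-Real.pi) Real.pi).1
  · exact Filter.Eventually.of_forall fun φ => mul_nonneg (abs_nonneg _) (sideMean_nonneg _)

/-! ### The arcsine and hypergeometric series. -/

/-- The coefficients of the power series of `(1 - x) ^ (-1 / 2)`. -/
noncomputable def invSqrtCoeff (n : ℕ) : ℝ :=
  ∏ i ∈ Finset.range n, (2 * (i : ℝ) + 1) / (2 * i + 2)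

theorem invSqrtCoeff_succ (n : ℕ) :
    invSqrtCoeff (n + 1) = invSqrtCoeff n * ((2 * n + 1) / (2 * n + 2)) :=
  Finset.prod_range_succ _ _

theorem invSqrtCoeff_pos (n : ℕ) : 0 < invSqrtCoeff n :=
  Finset.prod_pos fun _ _ => by positivity

theorem invSqrtCoeff_le_one (n : ℕ) : invSqrtCoeff n ≤ 1 :=
  Finset.prod_le_one (fun _ _ => by positivity) fun i _ => by
    rw [div_le_one (by positivity)]; linarith

theorem ascPochhammer_half (n : ℕ) :
    (ascPochhammer ℝ n).eval (1 / 2) = n.factorial * invSqrtCoeff n := by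
  induction n with
  | zero => simp [invSqrtCoeff]
  | succ n ih =>
    rw [ascPochhammer_succ_eval, ih, invSqrtCoeff_succ, Nat.factorial_succ]
    push_cast
    field_simp
    ring

theorem hasSum_inv_sqrt {x : ℝ} (hx : |x| < 1) :
    HasSum (fun n => invSqrtCoeff n * x ^ n) (1 / √(1 - x)) := by
  have h := (Real.one_div_one_sub_rpow_hasFPowerSeriesOnBall_zero (1 / 2)).hasSum (y := x)
    (by simpa [enorm_eq_nnnorm, ← NNReal.coe_lt_coe] using hx)
  simp only [FormalMultilinearSeries.ofScalars_apply_eq, zero_add, smul_eq_mul] at h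
  rw [← Real.sqrt_eq_rpow] at h
  have h1 (n : ℕ) : Ring.choose ((1 / 2 : ℝ) + n - 1) n = invSqrtCoeff n := by
    have h2 := Ring.factorial_nsmul_multichoose_eq_ascPochhammer (1 / 2 : ℝ) n
    rw [Polynomial.ascPochhammer_smeval_eq_eval, ascPochhammer_half, nsmul_eq_mul] at h2
    rw [Ring.choose, show (1 / 2 : ℝ) + n - 1 - n + 1 = 1 / 2 by ring]
    exact mul_left_cancel₀ (by positivity) h2
  simpa only [h1] using h

/-- Termwise integration of the binomial series of `(1 - u²)^(-1/2)` from `0` to `s`, dominated by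
the geometric series in `s²`. -/
theorem hasSum_arcsin {s : ℝ} (hs : |s| < 1) :
    HasSum (fun n : ℕ => invSqrtCoeff n / (2 * n + 1) * s ^ (2 * n + 1)) (Real.arcsin s) := by
  have hmem : ∀ u ∈ Set.uIcc 0 s, |u| ≤ |s| := fun u hu => by
    have := Set.abs_sub_left_of_mem_uIcc hu
    simpa using this
  have hsq : ∀ u : ℝ, |u| ≤ |s| → u ^ 2 ≤ s ^ 2 := fun u hu => sq_le_sq.2 hu
  have hs1 : s ^ 2 < 1 := by
    rw [← sq_abs]; nlinarith [abs_nonneg s]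
  have h := intervalIntegral.hasSum_integral_of_dominated_convergence (μ := volume)
    (a := 0) (b := s) (F := fun (n : ℕ) u => invSqrtCoeff n * (u ^ 2) ^ n)
    (f := fun u => 1 / √(1 - u ^ 2)) (fun n _ => (s ^ 2) ^ n)
    (fun n => Continuous.aestronglyMeasurable (by fun_prop))
    (fun n => Filter.Eventually.of_forall fun u hu => by
      have := hsq u (hmem u (Set.uIoc_subset_uIcc hu))
      rw [Real.norm_of_nonneg (mul_nonneg (invSqrtCoeff_pos n).le (by positivity))]
      calc invSqrtCoeff n * (u ^ 2) ^ n ≤ 1 * (s ^ 2) ^ n := by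
            gcongr
            exact invSqrtCoeff_le_one n
        _ = _ := one_mul _)
    (Filter.Eventually.of_forall fun u _ => summable_geometric_of_lt_one (sq_nonneg s) hs1)
    (by simp) (Filter.Eventually.of_forall fun u hu => by
      have := hsq u (hmem u (Set.uIoc_subset_uIcc hu))
      exact hasSum_inv_sqrt (by rw [abs_of_nonneg (sq_nonneg u)]; linarith))
  have h1 : ∫ u in (0 : ℝ)..s, 1 / √(1 - u ^ 2) = Real.arcsin s := by
    rw [intervalIntegral.integral_eq_sub_of_hasDerivAt (f := Real.arcsin)]
    · simp
    · intro u hu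
      have := hsq u (hmem u hu)
      refine Real.hasDerivAt_arcsin ?_ ?_ <;> rintro rfl <;> norm_num at this <;> linarith
    · refine ContinuousOn.intervalIntegrable fun u hu => ContinuousAt.continuousWithinAt ?_
      have := hsq u (hmem u hu)
      have h0 : √(1 - u ^ 2) ≠ 0 := (Real.sqrt_pos.2 (by linarith)).ne'
      fun_prop (disch := exact h0)
  rw [h1] at h
  have h2 (n : ℕ) : ∫ u in (0 : ℝ)..s, invSqrtCoeff n * (u ^ 2) ^ n =
      invSqrtCoeff n / (2 * n + 1) * s ^ (2 * n + 1) := by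
    simp only [← pow_mul, intervalIntegral.integral_const_mul, integral_pow]
    push_cast
    rw [zero_pow (by omega)]
    ring
  simpa only [h2] using h

/-- The coefficients of the power series of `₂F₁(1/2, 1/2; 2; x)`. -/
noncomputable def hypCoeff (n : ℕ) : ℝ :=
  2 * invSqrtCoeff n * invSqrtCoeff (n + 1) / (2 * n + 1)

theorem hypCoeff_zero : hypCoeff 0 = 1 := by
  simp [hypCoeff, invSqrtCoeff]

theorem hypCoeff_succ (n : ℕ) :
    hypCoeff (n + 1) = hypCoeff n * ((2 * n + 1) ^ 2 / (4 * (n + 1) * (n + 2))) := by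
  rw [hypCoeff, hypCoeff, invSqrtCoeff_succ (n + 1), invSqrtCoeff_succ n]
  push_cast
  field_simp
  ring

theorem hypCoeff_pos (n : ℕ) : 0 < hypCoeff n := by
  have := invSqrtCoeff_pos n
  have := invSqrtCoeff_pos (n + 1)
  unfold hypCoeff
  positivity

/-- The left side decreases in `n`. This Wallis-type bound makes `hypCoeff` of order `n⁻²`, hence
summable, so the hypergeometric series can be used up to `|cos θ| = 1`. -/
theorem invSqrtCoeff_sq_le (n : ℕ) : invSqrtCoeff n ^ 2 * (2 * n + 1) ≤ 1 := by
  induction n with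
  | zero => simp [invSqrtCoeff]
  | succ n ih =>
    refine le_trans ?_ ih
    rw [invSqrtCoeff_succ, mul_pow, mul_assoc]
    gcongr
    rw [div_pow, div_mul_eq_mul_div, div_le_iff₀ (by positivity)]
    push_cast
    nlinarith [(Nat.cast_nonneg n : (0 : ℝ) ≤ n)]

theorem hypCoeff_le (n : ℕ) : hypCoeff n ≤ 1 / ((n + 1) * (2 * n + 1)) := by
  have h := invSqrtCoeff_sq_le n
  rw [hypCoeff, invSqrtCoeff_succ]
  have : 2 * invSqrtCoeff n * (invSqrtCoeff n * ((2 * n + 1) / (2 * n + 2))) / (2 * n + 1) =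
      (invSqrtCoeff n ^ 2 * (2 * n + 1)) / ((n + 1) * (2 * n + 1)) := by
    field_simp
  rw [this]
  gcongr

theorem summable_hypCoeff : Summable hypCoeff := by
  refine Summable.of_nonneg_of_le (fun n => (hypCoeff_pos n).le) (fun n => ?_)
    ((summable_nat_add_iff 1).2 (Real.summable_one_div_nat_pow.2 one_lt_two))
  refine (hypCoeff_le n).trans ?_
  push_cast
  gcongr
  nlinarith [(Nat.cast_nonneg n : (0 : ℝ) ≤ n)]

theorem ascPochhammer_two (n : ℕ) : (ascPochhammer ℝ n).eval 2 = (n + 1).factorial := by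
  induction n with
  | zero => simp
  | succ n ih =>
    rw [ascPochhammer_succ_eval, ih, Nat.factorial_succ (n + 1)]
    push_cast
    ring

theorem ordinaryHypergeometric_half_half_two (x : ℝ) :
    ordinaryHypergeometric (1 / 2 : ℝ) (1 / 2 : ℝ) (2 : ℝ) x = ∑' n, hypCoeff n * x ^ n := by
  rw [ordinaryHypergeometric_eq_tsum]
  refine tsum_congr fun n => ?_
  rw [ascPochhammer_half, ascPochhammer_two, smul_eq_mul, hypCoeff, invSqrtCoeff_succ,
    Nat.factorial_succ]
  have : (n.factorial : ℝ) ≠ 0 := by positivity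
  push_cast
  field_simp

theorem hasSum_hypergeometric_mul {x : ℝ} (hx : |x| ≤ 1) :
    HasSum (fun n => hypCoeff n * x ^ (2 * n + 1))
      (ordinaryHypergeometric (1 / 2 : ℝ) (1 / 2 : ℝ) (2 : ℝ) (x ^ 2) * x) := by
  rw [ordinaryHypergeometric_half_half_two]
  have hs : Summable fun n => hypCoeff n * (x ^ 2) ^ n := by
    refine Summable.of_norm_bounded summable_hypCoeff fun n => ?_
    rw [Real.norm_of_nonneg (mul_nonneg (hypCoeff_pos n).le (by positivity))]
    exact mul_le_of_le_one_right (hypCoeff_pos n).le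
      (pow_le_one₀ (sq_nonneg x) ((sq_le_one_iff_abs_le_one x).2 hx))
  have h (n : ℕ) : hypCoeff n * (x ^ 2) ^ n * x = hypCoeff n * x ^ (2 * n + 1) := by ring
  simpa only [h] using hs.hasSum.mul_right x

/-- With `arccos = π / 2 - arcsin`, the constant contributes `π`. The arcsine series is integrated
termwise; for `φ` inside `(0, π)` one has `|cos φ| < 1`, which gives a geometric majorant. -/
theorem sideMean_eq {φ : ℝ} (hφ : φ ∈ Set.Ioo 0 Real.pi) :
    sideMean φ = Real.pi - Real.pi / 2 *
      (ordinaryHypergeometric (1 / 2 : ℝ) (1 / 2 : ℝ) (2 : ℝ) (Real.cos φ ^ 2) * Real.cos φ) := by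
  set x := Real.cos φ with hx
  have hx1 : |x| < 1 := by
    rw [← sq_lt_one_iff_abs_lt_one, hx, Real.cos_sq']
    have := pow_pos (Real.sin_pos_of_mem_Ioo hφ) 2
    linarith
  have hsin (t : ℝ) : |Real.sin t * x| ≤ |x| := by
    rw [abs_mul]
    exact mul_le_of_le_one_left (abs_nonneg _) (Real.abs_sin_le_one t)
  have hcoef (n : ℕ) : invSqrtCoeff n / (2 * n + 1) ≤ 1 := by
    rw [div_le_one (by positivity)]
    have := invSqrtCoeff_le_one n
    have : (0 : ℝ) ≤ n := Nat.cast_nonneg n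
    linarith
  have hcoef0 (n : ℕ) : 0 ≤ invSqrtCoeff n / (2 * n + 1) :=
    div_nonneg (invSqrtCoeff_pos n).le (by positivity)
  have h := intervalIntegral.hasSum_integral_of_dominated_convergence (μ := volume)
    (a := 0) (b := Real.pi)
    (F := fun (n : ℕ) t => Real.sin t *
      (invSqrtCoeff n / (2 * n + 1) * (Real.sin t * x) ^ (2 * n + 1)))
    (f := fun t => Real.sin t * Real.arcsin (Real.sin t * x)) (fun n _ => |x| ^ n)
    (fun n => Continuous.aestronglyMeasurable (by fun_prop))
    (fun n => Filter.Eventually.of_forall fun t _ => by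
      rw [norm_mul, norm_mul, norm_pow, Real.norm_of_nonneg (hcoef0 n), Real.norm_eq_abs,
        Real.norm_eq_abs]
      calc |Real.sin t| * (invSqrtCoeff n / (2 * n + 1) * |Real.sin t * x| ^ (2 * n + 1))
          ≤ 1 * (1 * |x| ^ (2 * n + 1)) := by
            refine mul_le_mul (Real.abs_sin_le_one t) ?_
              (mul_nonneg (hcoef0 n) (by positivity)) zero_le_one
            exact mul_le_mul (hcoef n) (pow_le_pow_left₀ (abs_nonneg _) (hsin t) _)
              (by positivity) zero_le_one
        _ ≤ |x| ^ n := by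
            rw [one_mul, one_mul]
            exact pow_le_pow_of_le_one (abs_nonneg _) hx1.le (by omega))
    (Filter.Eventually.of_forall fun t _ => summable_geometric_of_lt_one (abs_nonneg _) hx1)
    (by simp) (Filter.Eventually.of_forall fun t _ =>
      (hasSum_arcsin ((hsin t).trans_lt hx1)).mul_left _)
  have h1 (n : ℕ) : ∫ t in (0 : ℝ)..Real.pi, Real.sin t *
      (invSqrtCoeff n / (2 * n + 1) * (Real.sin t * x) ^ (2 * n + 1)) =
      Real.pi / 2 * (hypCoeff n * x ^ (2 * n + 1)) := by
    have : ∀ t : ℝ, Real.sin t *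
      (invSqrtCoeff n / (2 * n + 1) * (Real.sin t * x) ^ (2 * n + 1)) =
        invSqrtCoeff n / (2 * n + 1) * x ^ (2 * n + 1) * Real.sin t ^ (2 * (n + 1)) := by
      intro t; ring
    simp only [this]
    rw [intervalIntegral.integral_const_mul, integral_sin_pow_even]
    change _ * (_ * invSqrtCoeff (n + 1)) = _
    rw [hypCoeff]
    ring
  simp only [h1] at h
  have h2 := h.unique ((hasSum_hypergeometric_mul hx1.le).mul_left (Real.pi / 2))
  rw [← h2]
  have hac := Real.continuous_arcsin
  have h3 : ∀ t : ℝ, Real.sin t * Real.arccos (Real.sin t * x) =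
      Real.pi / 2 * Real.sin t - Real.sin t * Real.arcsin (Real.sin t * x) := by
    intro t
    rw [Real.arccos]
    ring
  rw [sideMean]
  simp only [← hx, h3]
  rw [intervalIntegral.integral_sub (Continuous.intervalIntegrable (by fun_prop) _ _)
    (Continuous.intervalIntegrable (by fun_prop) _ _), intervalIntegral.integral_const_mul,
    integral_sin, Real.cos_zero, Real.cos_pi]
  ring

theorem condMeanFun_pi_div_two_eq :
    condMeanFun (Real.pi / 2) = (1 / 4) * ∫ θ in (0 : ℝ)..Real.pi,
      (2 - ordinaryHypergeometric (1 / 2 : ℝ) (1 / 2 : ℝ) (2 : ℝ) (Real.cos θ ^ 2) *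
        Real.cos θ) * θ := by
  have hπ := Real.pi_pos
  have h : ∫ φ in (0 : ℝ)..Real.pi, φ * sideMean φ = Real.pi / 2 * ∫ θ in (0 : ℝ)..Real.pi,
      (2 - ordinaryHypergeometric (1 / 2 : ℝ) (1 / 2 : ℝ) (2 : ℝ) (Real.cos θ ^ 2) *
        Real.cos θ) * θ := by
    rw [← intervalIntegral.integral_const_mul, intervalIntegral.integral_of_le hπ.le,
      intervalIntegral.integral_of_le hπ.le, integral_Ioc_eq_integral_Ioo,
      integral_Ioc_eq_integral_Ioo]
    refine setIntegral_congr_fun measurableSet_Ioo fun φ hφ => ?_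
    simp only [sideMean_eq hφ]
    ring
  rw [condMeanFun_pi_div_two, h, ← mul_assoc]
  congr 1
  field_simp
  norm_num

/-! ### Termwise integration against `θ`. -/

/-- The integrals of `t * sin t ^ (2 n + 1)` over `[0, π / 2]`. -/
noncomputable def sinMoment : ℕ → ℝ
  | 0 => 1
  | n + 1 => (2 * n + 2) / (2 * n + 3) * sinMoment n + 1 / (2 * n + 3) ^ 2

theorem integral_mul_cos_pow (n : ℕ) :
    ∫ θ in (0 : ℝ)..Real.pi, θ * Real.cos θ ^ (2 * n + 1) = -2 * sinMoment n := by
  induction n with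
  | zero =>
    have h : ∀ θ ∈ Set.uIcc 0 Real.pi, HasDerivAt (fun θ => θ * Real.sin θ + Real.cos θ)
        (θ * Real.cos θ ^ (2 * 0 + 1)) θ := by
      intro θ _
      have := ((hasDerivAt_id θ).mul (Real.hasDerivAt_sin θ)).add (Real.hasDerivAt_cos θ)
      refine this.congr_deriv ?_
      simp
    rw [intervalIntegral.integral_eq_sub_of_hasDerivAt h
      (Continuous.intervalIntegrable (by fun_prop) _ _)]
    simp [sinMoment]
    norm_num
  | succ n ih =>
    -- This antiderivative packages the integration by parts that yields the recurrence; its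
    -- boundary values come only from the last term, because `sin` vanishes at both ends.
    have h : ∀ θ ∈ Set.uIcc 0 Real.pi, HasDerivAt (fun θ => θ * (Real.cos θ ^ (2 * n + 2) *
        Real.sin θ) + Real.cos θ ^ (2 * n + 3) / (2 * n + 3))
        ((2 * n + 3) * (θ * Real.cos θ ^ (2 * (n + 1) + 1)) -
          (2 * n + 2) * (θ * Real.cos θ ^ (2 * n + 1))) θ := by
      intro θ _
      have hc := Real.hasDerivAt_cos θ
      have := ((hasDerivAt_id θ).mul ((hc.pow (2 * n + 2)).mul (Real.hasDerivAt_sin θ))).add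
        ((hc.pow (2 * n + 3)).div_const (2 * n + 3))
      refine this.congr_deriv ?_
      have hne : (2 * (n : ℝ) + 3) ≠ 0 := by positivity
      simp only [id, Pi.pow_apply, Pi.mul_apply, show 2 * n + 2 - 1 = 2 * n + 1 by omega,
        show 2 * n + 3 - 1 = 2 * n + 2 by omega]
      push_cast
      have hs := Real.sin_sq_add_cos_sq θ
      field_simp
      have hs' : Real.sin θ ^ 2 = 1 - Real.cos θ ^ 2 := by linarith
      ring_nf
      rw [hs']
      ring
    have h1 := intervalIntegral.integral_eq_sub_of_hasDerivAt h
      (Continuous.intervalIntegrable (by fun_prop) _ _)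
    rw [intervalIntegral.integral_sub (Continuous.intervalIntegrable (by fun_prop) _ _)
      (Continuous.intervalIntegrable (by fun_prop) _ _), intervalIntegral.integral_const_mul,
      intervalIntegral.integral_const_mul, ih] at h1
    have hodd : (-1 : ℝ) ^ (2 * n + 3) = -1 := Odd.neg_one_pow ⟨n + 1, by ring⟩
    simp only [Real.sin_pi, Real.cos_pi, Real.sin_zero, Real.cos_zero, hodd, one_pow] at h1
    rw [sinMoment]
    have hne : (2 * (n : ℝ) + 3) ≠ 0 := by positivity
    refine mul_left_cancel₀ hne ?_
    field_simp at h1 ⊢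
    linarith

theorem hasSum_integral_hypergeometric :
    HasSum (fun n => hypCoeff n * (-2 * sinMoment n))
      (∫ θ in (0 : ℝ)..Real.pi, θ *
        (ordinaryHypergeometric (1 / 2 : ℝ) (1 / 2 : ℝ) (2 : ℝ) (Real.cos θ ^ 2) *
          Real.cos θ)) := by
  have hπ := Real.pi_pos
  have h := intervalIntegral.hasSum_integral_of_dominated_convergence (μ := volume)
    (a := 0) (b := Real.pi)
    (F := fun (n : ℕ) θ => θ * (hypCoeff n * Real.cos θ ^ (2 * n + 1)))
    (f := fun θ => θ *
        (ordinaryHypergeometric (1 / 2 : ℝ) (1 / 2 : ℝ) (2 : ℝ) (Real.cos θ ^ 2) *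
          Real.cos θ)) (fun n _ => Real.pi * hypCoeff n)
    (fun n => Continuous.aestronglyMeasurable (by fun_prop))
    (fun n => Filter.Eventually.of_forall fun t ht => by
      rw [Set.uIoc_of_le hπ.le] at ht
      rw [norm_mul, norm_mul, norm_pow, Real.norm_of_nonneg ht.1.le,
        Real.norm_of_nonneg (hypCoeff_pos n).le]
      have := hypCoeff_pos n
      refine mul_le_mul ht.2 (mul_le_of_le_one_right this.le
        (pow_le_one₀ (norm_nonneg _) (Real.abs_cos_le_one t))) (by positivity) hπ.le)
    (Filter.Eventually.of_forall fun t _ => summable_hypCoeff.mul_left _)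
    (by simp) (Filter.Eventually.of_forall fun t _ =>
      (hasSum_hypergeometric_mul (Real.abs_cos_le_one t)).mul_left _)
  have h1 (n : ℕ) : ∫ θ in (0 : ℝ)..Real.pi, θ * (hypCoeff n * Real.cos θ ^ (2 * n + 1)) =
      hypCoeff n * (-2 * sinMoment n) := by
    rw [← integral_mul_cos_pow, ← intervalIntegral.integral_const_mul]
    congr 1
    ext θ
    ring
  simpa only [h1] using h

/-! ### Bounds for `π` by Machin's formula. -/

theorem arctan_bounds {x : ℝ} (h0 : 0 ≤ x) (h1 : x < 1) (k : ℕ) :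
    ∑ i ∈ Finset.range (2 * k), (-1) ^ i * (x ^ (2 * i + 1) / (2 * i + 1)) ≤ Real.arctan x ∧
      Real.arctan x ≤
        ∑ i ∈ Finset.range (2 * k + 1), (-1) ^ i * (x ^ (2 * i + 1) / (2 * i + 1)) := by
  have h := (Real.hasSum_arctan (x := x) (by rwa [Real.norm_of_nonneg h0])).tendsto_sum_nat
  simp only [mul_div_assoc] at h
  push_cast at h
  have hanti : Antitone fun i : ℕ => x ^ (2 * i + 1) / (2 * (i : ℝ) + 1) := by
    intro i j hij
    have : (i : ℝ) ≤ j := Nat.cast_le.2 hij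
    exact div_le_div₀ (by positivity) (pow_le_pow_of_le_one h0 h1.le (by omega)) (by positivity)
      (by linarith)
  exact ⟨hanti.alternating_series_le_tendsto h k, hanti.tendsto_le_alternating_series h k⟩

theorem pi_bounds : (3.14159265358979323846264338327 : ℝ) < Real.pi ∧
    Real.pi < 3.14159265358979323846264338328 := by
  have h := Real.four_mul_arctan_inv_5_sub_arctan_inv_239
  -- With 22 and 23 terms at `1 / 5`, and 8 and 9 at `1 / 239`, the bracket for `π` has width about
  -- `10⁻³²`.
  obtain ⟨h1, h2⟩ := arctan_bounds (x := 5⁻¹) (by norm_num) (by norm_num) 11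
  obtain ⟨h3, h4⟩ := arctan_bounds (x := 239⁻¹) (by norm_num) (by norm_num) 4
  norm_num [Finset.sum_range_succ] at h1 h2 h3 h4
  constructor <;> linarith

/-! ### Exact evaluation of the first 250 terms. -/

/-- Evaluates its first argument before passing it on. -/
def Nat.force {α : Type} (x : ℕ) (f : ℕ → α) : α :=
  match x with
  | 0 => f 0
  | m + 1 => f (m + 1)

theorem Nat.force_eq {α : Type} (x : ℕ) (f : ℕ → α) : x.force f = f x := by
  cases x <;> rfl

/-- Iterates the recurrences of `hypCoeff n = p / q`, `sinMoment n = k / d` and of the partial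
sums `t / (q d)` of their product, and returns the final values scaled by `10 ^ 40`. -/
def partialSumLoop : ℕ → ℕ → ℕ → ℕ → ℕ → ℕ → ℕ → ℕ × ℕ × ℕ
  | 0, _, p, q, k, d, t =>
    (10 ^ 40 * t / (q * d), 10 ^ 40 * p / q, 10 ^ 40 * k / d)
  | m + 1, n, p, q, k, d, t =>
    ((t + p * k) * (4 * (n + 1) * (n + 2) * (2 * n + 3) ^ 2)).force fun t' =>
    (p * (2 * n + 1) ^ 2).force fun p' =>
    (q * (4 * (n + 1) * (n + 2))).force fun q' =>
    (k * ((2 * n + 2) * (2 * n + 3)) + d).force fun k' =>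
    (d * (2 * n + 3) ^ 2).force fun d' =>
    (n + 1).force fun n' => partialSumLoop m n' p' q' k' d' t'

theorem partialSumLoop_250 : partialSumLoop 250 0 1 1 1 1 0 =
    (11727882377185526386415709249332827812483, 50675973802630288143403817782797948,
      859178521339525671834507801343348446298) := by
  decide +kernel

theorem sinMoment_pos (n : ℕ) : 0 < sinMoment n := by
  induction n with
  | zero => simp [sinMoment]
  | succ n ih => rw [sinMoment]; positivity

theorem sinMoment_le_one (n : ℕ) : sinMoment n ≤ 1 := by
  induction n with
  | zero => simp [sinMoment]
  | succ n ih =>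
    rw [sinMoment]
    have h : (0 : ℝ) ≤ n := Nat.cast_nonneg n
    calc (2 * (n : ℝ) + 2) / (2 * n + 3) * sinMoment n + 1 / (2 * n + 3) ^ 2
        ≤ (2 * (n : ℝ) + 2) / (2 * n + 3) * 1 + 1 / (2 * n + 3) := by
          gcongr
          nlinarith
      _ = 1 := by field_simp; ring

theorem mem_Icc_div_of_nat_div {a q s : ℕ} (hq : 0 < q) :
    ((s * a / q : ℕ) : ℝ) ≤ s * ((a : ℝ) / q) ∧ s * ((a : ℝ) / q) ≤ (s * a / q : ℕ) + 1 := by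
  have hq' : (0 : ℝ) < q := Nat.cast_pos.2 hq
  have h1 : s * ((a : ℝ) / q) = ((s * a : ℕ) : ℝ) / q := by push_cast; ring
  rw [h1]
  refine ⟨Nat.cast_div_le, ?_⟩
  rw [div_le_iff₀ hq']
  have := (Nat.div_lt_iff_lt_mul hq).1 (Nat.lt_succ_self (s * a / q))
  exact_mod_cast this.le

/-- The hypotheses on the fractions are the loop invariant, preserved by the two recurrences without
any reduction of fractions. Rounding occurs once, in the final floor divisions, hence the intervals
of width `10⁻⁴⁰`. -/
theorem partialSumLoop_spec (m : ℕ) : ∀ n p q k d t : ℕ, 0 < q → 0 < d →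
    hypCoeff n = p / q → sinMoment n = k / d →
    ∑ i ∈ Finset.range n, hypCoeff i * sinMoment i = t / (q * d) →
    ∀ T c K : ℕ, partialSumLoop m n p q k d t = (T, c, K) →
      (∑ i ∈ Finset.range (n + m), hypCoeff i * sinMoment i ∈
        Set.Icc (T / 10 ^ 40 : ℝ) ((T + 1) / 10 ^ 40)) ∧
      (hypCoeff (n + m) ∈ Set.Icc (c / 10 ^ 40 : ℝ) ((c + 1) / 10 ^ 40)) ∧
      (sinMoment (n + m) ∈ Set.Icc (K / 10 ^ 40 : ℝ) ((K + 1) / 10 ^ 40)) := by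
  induction m with
  | zero =>
    intro n p q k d t hq hd hc hK hT T c K h
    rw [partialSumLoop, Prod.mk.injEq, Prod.mk.injEq] at h
    obtain ⟨rfl, rfl, rfl⟩ := h
    have h1 := mem_Icc_div_of_nat_div (a := t) (s := 10 ^ 40) (Nat.mul_pos hq hd)
    have h2 := mem_Icc_div_of_nat_div (a := p) (s := 10 ^ 40) hq
    have h3 := mem_Icc_div_of_nat_div (a := k) (s := 10 ^ 40) hd
    rw [Nat.cast_mul, ← hT] at h1
    rw [← hc] at h2
    rw [← hK] at h3
    rw [Nat.cast_pow, Nat.cast_ofNat] at h1 h2 h3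
    have h0 : (0 : ℝ) < 10 ^ 40 := by positivity
    simp only [Set.mem_Icc, div_le_iff₀ h0, le_div_iff₀ h0, add_zero, mul_comm _ ((10 : ℝ) ^ 40)]
    exact ⟨h1, h2, h3⟩
  | succ m ih =>
    intro n p q k d t hq hd hc hK hT T c K h
    simp only [partialSumLoop, Nat.force_eq] at h
    have hq' : (q : ℝ) ≠ 0 := (Nat.cast_pos.2 hq).ne'
    have hd' : (d : ℝ) ≠ 0 := (Nat.cast_pos.2 hd).ne'
    have := ih (n + 1) _ _ _ _ _ (by positivity) (by positivity) ?_ ?_ ?_ T c K h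
    · rwa [show n + 1 + m = n + (m + 1) by ring] at this
    · rw [hypCoeff_succ, hc]
      push_cast
      field_simp
    · rw [sinMoment, hK]
      push_cast
      field_simp
    · rw [Finset.sum_range_succ, hT, hc, hK]
      push_cast
      field_simp

theorem partialSum_bounds :
    (∑ i ∈ Finset.range 250, hypCoeff i * sinMoment i ∈
        Set.Icc (11727882377185526386415709249332827812483 / 10 ^ 40 : ℝ)
          (11727882377185526386415709249332827812484 / 10 ^ 40)) ∧
      (hypCoeff 250 ∈ Set.Icc (50675973802630288143403817782797948 / 10 ^ 40 : ℝ)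
        (50675973802630288143403817782797949 / 10 ^ 40)) ∧
      (sinMoment 250 ∈ Set.Icc (859178521339525671834507801343348446298 / 10 ^ 40 : ℝ)
        (859178521339525671834507801343348446299 / 10 ^ 40)) := by
  have h := partialSumLoop_spec 250 0 1 1 1 1 0 one_pos one_pos (by simp [hypCoeff_zero])
    (by simp [sinMoment]) (by simp) _ _ _ partialSumLoop_250
  norm_num at h ⊢
  exact h

/-! ### The tail of the series. -/

/-- The numerator of the rational function approximating the coefficient of `sinMoment n` in the
tail of the series, in the variable `4 n + 3`. -/
noncomputable def tailP (y : ℝ) : ℝ :=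
  (1616615 * y ^ 9 + 4203199 * y ^ 8 + 6651216 * y ^ 7 + 3695120 * y ^ 6 - 21834800 * y ^ 5 -
    37855600 * y ^ 4 + 261578320 * y ^ 3 + 774225680 * y ^ 2 - 6194807600 * y - 26055564400) /
    (9699690 * y ^ 8)

/-- The rational function approximating the remaining part of the tail of the series, in the
variable `4 n + 3`. -/
noncomputable def tailQ (y : ℝ) : ℝ :=
  (21727305600 * y ^ 8 - 27521253760 * y ^ 7 - 128760151520 * y ^ 6 + 176436067808 * y ^ 5 +
    1247664187952 * y ^ 4 - 1622895716912 * y ^ 3 - 23247176617398 * y ^ 2 +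
    26275328691638 * y + 715156102922837) / (260727667200 * y ^ 8)

/-- For `c_n (P K_n + Q)` to telescope to `c_n K_n`, the coefficient of `K_n` must satisfy `P(y) -
R(y) P(y + 4) = 1`, where `R` is the product of the ratio of the `c_n` and the linear factor in the
recurrence of `K_n`. `tailP` is an approximate solution in powers of `1 / y`, with leading term `y /
6`. -/
theorem tailP_sub {y : ℝ} (hy : 1003 ≤ y) :
    |tailP y - (y - 1) ^ 2 / ((y + 5) * (y + 3)) * tailP (y + 4) - 1| ≤ 1.2e-24 := by
  -- After this shift and clearing denominators, both inequalities become polynomials in `z ≥ 0`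
  -- with nonnegative coefficients. The value `1003` is `4 * 250 + 3`.
  obtain ⟨z, hz, rfl⟩ : ∃ z : ℝ, 0 ≤ z ∧ y = z + 1003 := ⟨y - 1003, by linarith, by ring⟩
  unfold tailP
  rw [div_mul_div_comm, div_sub_div _ _ (by positivity) (by positivity),
    div_sub_one (by positivity), abs_div, div_le_iff₀ (by positivity),
    abs_of_pos (a := _ * _) (by positivity), abs_le]
  constructor
  · rw [← sub_nonneg]
    ring_nf
    positivity
  · rw [← sub_nonneg]
    ring_nf
    positivity

/-- The part of the telescoping condition free of `K_n`: `Q` absorbs the inhomogeneous term `1 / (2n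
+ 3)² = 4 / (y + 3)²` of the recurrence of `K_n`. -/
theorem tailQ_sub {y : ℝ} (hy : 1003 ≤ y) :
    |tailQ y - (y - 1) ^ 2 / ((y + 1) * (y + 5)) * (tailQ (y + 4) + 4 * tailP (y + 4) /
      (y + 3) ^ 2)| ≤ 1.3e-25 := by
  obtain ⟨z, hz, rfl⟩ : ∃ z : ℝ, 0 ≤ z ∧ y = z + 1003 := ⟨y - 1003, by linarith, by ring⟩
  unfold tailP tailQ
  rw [← mul_div_assoc, div_div, div_add_div _ _ (by positivity) (by positivity),
    div_mul_div_comm, div_sub_div _ _ (by positivity) (by positivity),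
    abs_div, div_le_iff₀ (by positivity),
    abs_of_pos (a := _ * _) (by positivity), abs_le]
  constructor
  · rw [← sub_nonneg]
    ring_nf
    positivity
  · rw [← sub_nonneg]
    ring_nf
    positivity

/-- An approximation of the tail `∑ i ≥ n, hypCoeff i * sinMoment i`. -/
noncomputable def tailApprox (n : ℕ) : ℝ :=
  hypCoeff n * (tailP (4 * n + 3) * sinMoment n + tailQ (4 * n + 3))

/-- The two defects add up to `1.33e-24` because `K_n ≤ 1`, and the factor `c_n` is at most `1 / (n
(n + 1))`, which telescopes when summed over `n`. -/
theorem tailApprox_sub (n : ℕ) (hn : 250 ≤ n) :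
    |tailApprox (n + 1) + hypCoeff n * sinMoment n - tailApprox n| ≤
      1.33e-24 * (1 / (n : ℝ) - 1 / ((n + 1 : ℕ) : ℝ)) := by
  have hn' : (250 : ℝ) ≤ n := by exact_mod_cast hn
  have hy : (1003 : ℝ) ≤ 4 * n + 3 := by linarith
  have h1 := tailP_sub hy
  have h2 := tailQ_sub hy
  set y : ℝ := 4 * n + 3 with hydef
  have hy' : 4 * ((n + 1 : ℕ) : ℝ) + 3 = y + 4 := by rw [hydef]; push_cast; ring
  have hr1 : (2 * (n : ℝ) + 1) ^ 2 / (4 * (n + 1) * (n + 2)) * ((2 * n + 2) / (2 * n + 3)) =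
      (y - 1) ^ 2 / ((y + 5) * (y + 3)) := by
    rw [hydef]; field_simp; ring
  have hr2 : (2 * (n : ℝ) + 1) ^ 2 / (4 * (n + 1) * (n + 2)) =
      (y - 1) ^ 2 / ((y + 1) * (y + 5)) := by
    rw [hydef]; field_simp; ring
  have hr3 : 1 / (2 * (n : ℝ) + 3) ^ 2 = 4 / (y + 3) ^ 2 := by
    rw [hydef]; field_simp; ring
  have hkey : tailApprox (n + 1) + hypCoeff n * sinMoment n - tailApprox n =
      -(hypCoeff n * ((tailP y - (y - 1) ^ 2 / ((y + 5) * (y + 3)) * tailP (y + 4) - 1) *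
          sinMoment n + (tailQ y - (y - 1) ^ 2 / ((y + 1) * (y + 5)) *
            (tailQ (y + 4) + 4 * tailP (y + 4) / (y + 3) ^ 2)))) := by
    rw [tailApprox, tailApprox, hy', hypCoeff_succ, sinMoment, hr3, ← hr1, ← hr2]
    ring
  have hK0 := sinMoment_pos n
  have hK1 := sinMoment_le_one n
  have hc0 := hypCoeff_pos n
  rw [hkey, abs_neg, abs_mul, abs_of_pos hc0]
  calc hypCoeff n * |(tailP y - (y - 1) ^ 2 / ((y + 5) * (y + 3)) * tailP (y + 4) - 1) *
          sinMoment n + (tailQ y - (y - 1) ^ 2 / ((y + 1) * (y + 5)) *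
            (tailQ (y + 4) + 4 * tailP (y + 4) / (y + 3) ^ 2))|
      ≤ 1 / ((n + 1) * (2 * n + 1)) * 1.33e-24 := by
        refine mul_le_mul (hypCoeff_le n) ?_ (abs_nonneg _) (by positivity)
        refine (abs_add_le _ _).trans ?_
        rw [abs_mul, abs_of_pos hK0]
        have := mul_le_mul h1 hK1 hK0.le (by norm_num)
        linarith
    _ ≤ 1.33e-24 * (1 / (n : ℝ) - 1 / ((n + 1 : ℕ) : ℝ)) := by
        rw [mul_comm]
        refine mul_le_mul_of_nonneg_left ?_ (by norm_num)
        push_cast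
        rw [div_sub_div _ _ (by positivity) (by positivity)]
        rw [div_le_div_iff₀ (by positivity) (by positivity)]
        nlinarith

theorem tendsto_tailApprox : Filter.Tendsto tailApprox Filter.atTop (𝓝 0) := by
  refine squeeze_zero_norm (a := fun n : ℕ => 16 * (1 / ((n : ℝ) + 1))) (fun n => ?_)
    (by simpa using tendsto_one_div_add_atTop_nhds_zero_nat.const_mul (16 : ℝ))
  have hn : (0 : ℝ) ≤ n := Nat.cast_nonneg n
  have hK0 := sinMoment_pos n
  have hK1 := sinMoment_le_one n
  have hc0 := hypCoeff_pos n
  have hc1 := hypCoeff_le n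
  set y : ℝ := 4 * n + 3 with hydef
  have hy : 3 ≤ y := by linarith
  have hP : |tailP y| ≤ 2 * y := by
    unfold tailP
    obtain ⟨z, hz, hyz⟩ : ∃ z : ℝ, 0 ≤ z ∧ y = z + 3 := ⟨y - 3, by linarith, by ring⟩
    rw [hyz, abs_div, div_le_iff₀ (by positivity), abs_of_pos (a := _ * _) (by positivity), abs_le]
    constructor <;> (rw [← sub_nonneg]; ring_nf; positivity)
  have hQ : |tailQ y| ≤ 2 * y := by
    unfold tailQ
    obtain ⟨z, hz, hyz⟩ : ∃ z : ℝ, 0 ≤ z ∧ y = z + 3 := ⟨y - 3, by linarith, by ring⟩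
    rw [hyz, abs_div, div_le_iff₀ (by positivity), abs_of_pos (a := _ * _) (by positivity), abs_le]
    constructor <;> (rw [← sub_nonneg]; ring_nf; positivity)
  rw [tailApprox, ← hydef, norm_mul, Real.norm_of_nonneg hc0.le, Real.norm_eq_abs]
  calc hypCoeff n * |tailP y * sinMoment n + tailQ y|
      ≤ 1 / ((n + 1) * (2 * n + 1)) * (4 * y) := by
        refine mul_le_mul hc1 ?_ (abs_nonneg _) (by positivity)
        refine (abs_add_le _ _).trans ?_
        rw [abs_mul, abs_of_pos hK0]
        have := mul_le_mul hP hK1 hK0.le (by positivity)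
        linarith
    _ ≤ 16 * (1 / ((n : ℝ) + 1)) := by
        rw [hydef, one_div_mul_eq_div, mul_one_div, div_le_div_iff₀ (by positivity) (by positivity)]
        nlinarith

theorem abs_partialSum_add_tailApprox_sub_le (m : ℕ) :
    |(∑ i ∈ Finset.range (250 + m), hypCoeff i * sinMoment i + tailApprox (250 + m)) -
      (∑ i ∈ Finset.range 250, hypCoeff i * sinMoment i + tailApprox 250)| ≤
      1.33e-24 * (1 / 250 - 1 / ((250 + m : ℕ) : ℝ)) := by
  induction m with
  | zero => simp
  | succ m ih =>
    have h := tailApprox_sub (250 + m) (by omega)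
    rw [← add_assoc, Finset.sum_range_succ]
    rw [abs_le] at h ih ⊢
    constructor <;> linarith [h.1, h.2, ih.1, ih.2]

/-- Partial sum plus `tailApprox` drifts by at most the telescoped error from index 250 on, and
tends to `S` because `tailApprox` tends to `0`. -/
theorem abs_tsum_sub_le {S : ℝ} (hS : HasSum (fun n => hypCoeff n * sinMoment n) S) :
    |S - (∑ i ∈ Finset.range 250, hypCoeff i * sinMoment i + tailApprox 250)| ≤
      1.33e-24 / 250 := by
  have h1 : Filter.Tendsto (fun m => |(∑ i ∈ Finset.range (250 + m), hypCoeff i * sinMoment i +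
      tailApprox (250 + m)) - (∑ i ∈ Finset.range 250, hypCoeff i * sinMoment i +
        tailApprox 250)|) Filter.atTop
      (𝓝 |(S + 0) - (∑ i ∈ Finset.range 250, hypCoeff i * sinMoment i + tailApprox 250)|) := by
    have hadd : Filter.Tendsto (fun m : ℕ => 250 + m) Filter.atTop Filter.atTop :=
      Filter.tendsto_atTop_mono (fun m => Nat.le_add_left m 250) Filter.tendsto_id
    exact (((hS.tendsto_sum_nat.comp hadd).add (tendsto_tailApprox.comp hadd)).sub_const _).abs
  rw [add_zero] at h1
  refine le_of_tendsto h1 (Filter.Eventually.of_forall fun m => ?_)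
  refine (abs_partialSum_add_tailApprox_sub_le m).trans ?_
  have : (0 : ℝ) ≤ 1 / ((250 + m : ℕ) : ℝ) := by positivity
  linarith

/-! ### Numerical value and conclusion. -/

theorem continuous_hypergeometric_cos : Continuous fun θ : ℝ =>
    ordinaryHypergeometric (1 / 2 : ℝ) (1 / 2 : ℝ) (2 : ℝ) (Real.cos θ ^ 2) * Real.cos θ := by
  have h : (fun θ : ℝ => ordinaryHypergeometric (1 / 2 : ℝ) (1 / 2 : ℝ) (2 : ℝ)
      (Real.cos θ ^ 2) * Real.cos θ) =
      fun θ => ∑' n, hypCoeff n * Real.cos θ ^ (2 * n + 1) := by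
    ext θ
    exact (hasSum_hypergeometric_mul (Real.abs_cos_le_one θ)).tsum_eq.symm
  rw [h]
  refine continuous_tsum (fun n => by fun_prop) summable_hypCoeff fun n θ => ?_
  rw [norm_mul, norm_pow, Real.norm_of_nonneg (hypCoeff_pos n).le]
  exact mul_le_of_le_one_right (hypCoeff_pos n).le
    (pow_le_one₀ (norm_nonneg _) (Real.abs_cos_le_one θ))

theorem exists_hasSum_and_integral_eq : ∃ S : ℝ, HasSum (fun n => hypCoeff n * sinMoment n) S ∧
    (1 / 4) * ∫ θ in (0 : ℝ)..Real.pi,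
      (2 - ordinaryHypergeometric (1 / 2 : ℝ) (1 / 2 : ℝ) (2 : ℝ) (Real.cos θ ^ 2) *
        Real.cos θ) * θ = Real.pi ^ 2 / 4 + S / 2 := by
  have hF := continuous_hypergeometric_cos
  have h1 := hasSum_integral_hypergeometric.mul_left (-1 / 2)
  refine ⟨-1 / 2 * ∫ θ in (0 : ℝ)..Real.pi, θ *
    (ordinaryHypergeometric (1 / 2 : ℝ) (1 / 2 : ℝ) (2 : ℝ) (Real.cos θ ^ 2) * Real.cos θ), ?_, ?_⟩
  · have e (n : ℕ) : -1 / 2 * (hypCoeff n * (-2 * sinMoment n)) = hypCoeff n * sinMoment n := by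
      ring
    simpa only [e] using h1
  · have e (θ : ℝ) : (2 - ordinaryHypergeometric (1 / 2 : ℝ) (1 / 2 : ℝ) (2 : ℝ) (Real.cos θ ^ 2) *
        Real.cos θ) * θ = 2 * θ - θ * (ordinaryHypergeometric (1 / 2 : ℝ) (1 / 2 : ℝ) (2 : ℝ)
          (Real.cos θ ^ 2) * Real.cos θ) := by
      ring
    have hG : Continuous fun θ : ℝ => θ * (ordinaryHypergeometric (1 / 2 : ℝ) (1 / 2 : ℝ) (2 : ℝ)
        (Real.cos θ ^ 2) * Real.cos θ) := continuous_id.mul hF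
    have hL : Continuous fun θ : ℝ => 2 * θ := by fun_prop
    simp only [e]
    rw [intervalIntegral.integral_sub (hL.intervalIntegrable _ _) (hG.intervalIntegrable _ _),
      intervalIntegral.integral_const_mul, integral_id]
    ring

theorem integral_mem_Ico :
    ((1 / 4) * ∫ θ in (0 : ℝ)..Real.pi,
          (2 - ordinaryHypergeometric (1 / 2 : ℝ) (1 / 2 : ℝ) (2 : ℝ) (Real.cos θ ^ 2) *
            Real.cos θ) * θ) ∈
        Set.Ico (3.0538319164380270202505577 : ℝ) 3.0538319164380270202505578 := by
  obtain ⟨S, hS, hI⟩ := exists_hasSum_and_integral_eq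
  rw [hI]
  obtain ⟨hπ1, hπ2⟩ := pi_bounds
  have hsq1 : (3.14159265358979323846264338327 : ℝ) ^ 2 ≤ Real.pi ^ 2 := by gcongr
  have hsq2 : Real.pi ^ 2 ≤ (3.14159265358979323846264338328 : ℝ) ^ 2 := by gcongr
  have hS' := abs_le.1 (abs_tsum_sub_le hS)
  obtain ⟨⟨hT1, hT2⟩, ⟨hc1, hc2⟩, ⟨hK1, hK2⟩⟩ := partialSum_bounds
  have hG : tailApprox 250 = hypCoeff 250 * (tailP 1003 * sinMoment 250 + tailQ 1003) := by
    rw [tailApprox]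
    norm_num
  have hP : 0 ≤ tailP 1003 := by norm_num [tailP]
  have hQ : 0 ≤ tailQ 1003 := by norm_num [tailQ]
  have hc0 := hypCoeff_pos 250
  have hK0 := sinMoment_pos 250
  -- All factors are nonnegative, so the endpoints of the intervals for `c_250` and `K_250` bound
  -- the tail term. The truncation error `1.33e-24 / 250` is well below the `10⁻²⁵` unit of the last
  -- digit.
  have hG1 := mul_le_mul hc1 (add_le_add_left (mul_le_mul_of_nonneg_left hK1 hP) (tailQ 1003))
    (by positivity) hc0.le
  have hG2 := mul_le_mul hc2 (add_le_add_left (mul_le_mul_of_nonneg_left hK2 hP) (tailQ 1003))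
    (by positivity) (by norm_num)
  rw [← hG] at hG1 hG2
  norm_num [tailP, tailQ] at hG1 hG2
  constructor
  · norm_num at *
    linarith [hS'.1]
  · norm_num at *
    linarith [hS'.2]

theorem mainTheorem2 {Ω : Type*} [MeasurableSpace Ω] (μ : Measure Ω) [IsProbabilityMeasure μ]
    (A B C : Ω → UnitSphere) (hA : Measurable A) (hB : Measurable B) (hC : Measurable C)
    (hindep : iIndepFun ![A, B, C] μ)
    (hAlaw : μ.map A = uniformSphere) (hBlaw : μ.map B = uniformSphere)
    (hClaw : μ.map C = uniformSphere) :
    IsCondMeanAt μ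
        (fun ω => sphAngle (A ω) (B ω) (C ω) * sphSide (B ω) (C ω))
        (fun ω => sphSide (C ω) (A ω))
        (Real.pi / 2)
        ((1 / 4) * ∫ θ in (0 : ℝ)..Real.pi,
          (2 - ordinaryHypergeometric (1 / 2 : ℝ) (1 / 2 : ℝ) (2 : ℝ) (Real.cos θ ^ 2) *
            Real.cos θ) * θ) ∧
      ((1 / 4) * ∫ θ in (0 : ℝ)..Real.pi,
          (2 - ordinaryHypergeometric (1 / 2 : ℝ) (1 / 2 : ℝ) (2 : ℝ) (Real.cos θ ^ 2) *
            Real.cos θ) * θ) ∈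
        Set.Ico (3.0538319164380270202505577 : ℝ) 3.0538319164380270202505578 := by
  refine ⟨?_, integral_mem_Ico⟩
  rw [← condMeanFun_pi_div_two_eq]
  exact isCondMeanAt_condMeanFun μ A B C hA hB hC hindep hAlaw hBlaw hClaw
    ⟨by positivity, by linarith [Real.pi_pos]⟩
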